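/- Let $\alpha,\beta>-1$ and let $w_{\alpha,\beta}(t)=(1-t)^\alpha(1+t)^\beta$ on $[-1,1]$. For $1\le p<\infty$ let $L_p(w_{\alpha,\beta})$ be the space of complex-valued Lebesgue measurable functions $f$ on $[-1,1]$ with $\|f\|_{L_p(w_{\alpha,\beta})}=\bigl(\int_{-1}^1|f(t)|^p\,w_{\alpha,\beta}(t)\,dt\bigr)^{1/p}<\infty$. Let $P_n^{(\alpha,\beta)}$, $n\in\mathbb{N}_0=\{0,1,2,\dots\}$, be the Jacobi polynomials (with the usual normalization), let $\widetilde P_n^{(\alpha,\beta)}=\bigl(h_n^{(\alpha,\beta)}\bigr)^{-1}P_n^{(\alpha,\beta)}$, where $h_n^{(\alpha,\beta)}=\bigl(\int_{-1}^1 (P_n^{(\alpha,\beta)})^2\,w_{\alpha,\beta}\,dt\bigr)^{1/2}$, be the orthonormal Jacobi polynomials, and let $\hat f_n=\int_{-1}^1 f(t)\,\widetilde P_n^{(\alpha,\beta)}(t)\,w_{\alpha,\beta}(t)\,dt$. Put $\sigma=\sigma(\alpha,\beta)=\max\bigl(0,\tfrac12+\max(\alpha,\beta)\bigr)$, and let $r'$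 denote the exponent conjugate to $r$, $\tfrac1r+\tfrac1{r'}=1$. For a positive function $\omega$ on $\mathbb{N}_0$ put $$M_\omega=\sup_{t>0}\Bigl\{t\sum_{\omega(n)\ge t}(n+1)^{2\sigma}\Bigr\}.$$ Then there are finite constants $A_p$, $1<p\le2$, depending only on $p$, $\alpha$ and $\beta$, such that the following holds. (a) If $1<p\le 2$, $f\in L_p(w_{\alpha,\beta})$ and $\omega$ is a positive function on $\mathbb{N}_0$ with $M_\omega<\infty$, then $$\Bigl\{\sum_{n=0}^\infty\Bigl((n+1)^{(\frac1p-\frac1{p'})\sigma}\,\omega(n)^{\frac1p-\frac1{p'}}\,|\hat f_n|\Bigr)^p\Bigr\}^{1/p}\le A_p\,M_\omega^{\frac1p-\frac1{p'}}\,\|f\|_{L_p(w_{\alpha,\beta})}.$$ (b) If $2\le q<\infty$, $\omega$ is a positive function on $\mathbb{N}_0$ with $M_\omega<\infty$, and $\phi$ is a non-negative function on $\mathbb{N}_0$ such that $$\sum_{n=0}^\infty\Bigl((n+1)^{(\frac1q-\frac1{q'})\sigma}\,\omega(n)^{\frac1q-\frac1{q'}}\,|\phi(n)|\Bigr)^q<\infty,$$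 then the polynomials $\Phi_N=\sum_{n=0}^N\phi(n)\,\widetilde P_n^{(\alpha,\beta)}$ converge, as $N\to\infty$, in $L_q(w_{\alpha,\beta})$ to a function $f$ satisfying $\hat f_n=\phi(n)$ for all $n\in\mathbb{N}_0$ and $$\|f\|_{L_q(w_{\alpha,\beta})}\le A_{q'}\,M_\omega^{\frac1{q'}-\frac1q}\Bigl\{\sum_{n=0}^\infty\Bigl((n+1)^{(\frac1q-\frac1{q'})\sigma}\,\omega(n)^{\frac1q-\frac1{q'}}\,|\phi(n)|\Bigr)^q\Bigr\}^{1/q}.$$ -/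

import Mathlib

open MeasureTheory Filter Topology Polynomial
open scoped ENNReal NNReal

noncomputable section

namespace JacobiExpansion

/-- The Jacobi weight `(1 - t) ^ α * (1 + t) ^ β`. -/
def weight (α β t : ℝ) : ℝ := (1 - t) ^ α * (1 + t) ^ β

/-- The measure `(1 - t) ^ α * (1 + t) ^ β dt` on `[-1, 1]`. -/
def weightMeasure (α β : ℝ) : Measure ℝ :=
  (volume.restrict (Set.Icc (-1 : ℝ) 1)).withDensity fun t => ENNReal.ofReal (weight α β t)

/-- The Jacobi polynomial
`P_n^{(α,β)}(t) = ∑_{k ≤ n} (n+α+β+1)_k (α+k+1)_{n-k} / (k! (n-k)!) * ((t-1)/2)^k`,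
where `(x)_k = x (x+1) ⋯ (x+k-1)`. This is the terminating hypergeometric expression
`(α+1)_n / n! * ₂F₁(-n, n+α+β+1; α+1; (1-t)/2)` with denominators cleared. -/
def jacobi (α β : ℝ) (n : ℕ) : ℝ[X] :=
  ∑ k ∈ Finset.range (n + 1),
    C ((ascPochhammer ℝ k).eval ((n : ℝ) + α + β + 1) *
        (ascPochhammer ℝ (n - k)).eval (α + (k : ℝ) + 1) /
        ((k.factorial : ℝ) * ((n - k).factorial : ℝ))) *
      (C (1 / 2) * (X - 1)) ^ k

/-- The norm `h_n` of the `n`-th Jacobi polynomial in `L₂` of the Jacobi weight. -/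
def jacobiNorm (α β : ℝ) (n : ℕ) : ℝ :=
  √(∫ t, ((jacobi α β n).eval t) ^ 2 ∂(weightMeasure α β))

/-- The orthonormal Jacobi polynomial `h_n⁻¹ P_n`. -/
def orthonormalJacobi (α β : ℝ) (n : ℕ) : ℝ[X] :=
  C (jacobiNorm α β n)⁻¹ * jacobi α β n

/-- The `n`-th Fourier-Jacobi coefficient of `f`. -/
def coeff (α β : ℝ) (f : ℝ → ℂ) (n : ℕ) : ℂ :=
  ∫ t, f t * (((orthonormalJacobi α β n).eval t : ℝ) : ℂ) ∂(weightMeasure α β)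

/-- The partial sum `∑_{n ≤ N} φ(n) P̃_n(t)`, as a complex-valued function of `t`. -/
def partialSum (α β : ℝ) (φ : ℕ → ℝ) (N : ℕ) (t : ℝ) : ℂ :=
  ((∑ n ∈ Finset.range (N + 1), φ n * (orthonormalJacobi α β n).eval t : ℝ) : ℂ)

/-- `σ(α, β) = max (0, 1/2 + max (α, β))`. -/
def sigma (α β : ℝ) : ℝ := max 0 (1 / 2 + max α β)

/-- `M_ω = sup_{t > 0} t * ∑_{ω(n) ≥ t} (n + 1) ^ (2σ)`, with values in `[0, ∞]`. -/
def M (α β : ℝ) (ω : ℕ → ℝ) : ℝ≥0∞ :=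
  ⨆ (t : ℝ) (_ : 0 < t), ENNReal.ofReal t *
    ∑' n : {n : ℕ // t ≤ ω n}, ENNReal.ofReal (((n : ℕ) + 1 : ℝ) ^ (2 * sigma α β))

/-- `1/r - 1/r'`, where `r'` is the exponent conjugate to `r`. -/
def expDiff (r : ℝ) : ℝ := 1 / r - 1 / Real.conjExponent r

/-- The weighted sum
`∑_n ((n + 1) ^ ((1/r - 1/r') σ) * ω(n) ^ (1/r - 1/r') * |c_n|) ^ r`, with values in `[0, ∞]`. -/
def paleySum (α β : ℝ) (ω : ℕ → ℝ) (r : ℝ) (c : ℕ → ℂ) : ℝ≥0∞ :=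
  ∑' n : ℕ, ENNReal.ofReal
    ((((n : ℝ) + 1) ^ (expDiff r * sigma α β) * ω n ^ expDiff r * ‖c n‖) ^ r)

end JacobiExpansion

end

/-!
Two facts carry the proof.

*The orthonormal Jacobi polynomials are bounded by `K (n + 1) ^ σ` on `[-1, 1]`*
(`exists_isBoundedOrthonormal`). For a Jacobi polynomial `y` with eigenvalue `λ`, Sonin's function
`λ y² + (1 - t²) y'²` dominates `λ y²` and has derivative `2 (α - β + (α + β + 1) t) y'²`, whose
sign is that of an affine function of `t`, equal to `2α + 1` at `1` and to `-(2β + 1)` at `-1`.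
If `α` or `β` is at least `-1/2`, the maximum of `|y|` is therefore attained at an endpoint
(`jacobi_sq_le_max`). The endpoint values are explicit, the norm follows by induction on the degree
because the derivative of `P_{n+1}^{(α,β)}` is a multiple of `P_n^{(α+1,β+1)}` (`normSq_eq`), and
Euler's limit for the Gamma function gives the growth of the quotient (`exists_endpoint_bound`).
If both parameters are below `-1/2`, the maximum of Sonin's function is at an interior point
independent of `n`, and near that point the function stays comparable to its maximum; its integral
against the weight is `2 λ` times the squared norm, so the orthonormal polynomials are uniformly
bounded (`exists_jacobi_sq_le_normSq`).

*Paley's inequality holds for every orthonormal system with `|u_n| ≤ K a(n)`*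
(`IsBoundedOrthonormal.paley`). Give `n` the mass `(a(n) ω(n))²`. The map sending `f` to
`(|c_n(f)| / (a(n) ω(n)))_n` is of weak type `(2, 2)` by Bessel's inequality. It is of weak type
`(1, 1)` because `|c_n(f)| ≤ K a(n) ‖f‖₁`, so that it exceeds `y` only where
`ω(n) ≤ K ‖f‖₁ / y`, a set whose mass is controlled by `M_ω` (`tsum_sublevel_le`). Marcinkiewicz
interpolation, carried out by hand in order to keep track of `M_ω`, gives the case `1 < p < 2`. The
statement for `q ≥ 2` follows by duality, first for finite sums
(`IsBoundedOrthonormal.eLpNorm_sum_le`), which makes the partial sums a Cauchy sequence in `L_q`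
(`IsBoundedOrthonormal.paley_dual`).
-/

noncomputable section

namespace JacobiExpansion

/-! ### Orthonormal systems of bounded functions -/

/-- The quantity `M_ω = sup_{t > 0} t * ∑_{ω(n) ≥ t} a(n) ^ 2`, for a general majorant `a` in place of
`(n + 1) ^ σ`. -/
def levelSup (a ω : ℕ → ℝ) : ℝ≥0∞ :=
  ⨆ (t : ℝ) (_ : 0 < t), ENNReal.ofReal t * ∑' n : {n : ℕ // t ≤ ω n}, ENNReal.ofReal (a n ^ 2)

lemma levelSup_pos {a ω : ℕ → ℝ} (ha : ∀ n, 0 < a n) (hω : ∀ n, 0 < ω n) : 0 < levelSup a ω := by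
  refine lt_of_lt_of_le ?_ (le_iSup₂ (f := fun (t : ℝ) (_ : 0 < t) => ENNReal.ofReal t *
    ∑' n : {n : ℕ // t ≤ ω n}, ENNReal.ofReal (a n ^ 2)) (ω 0) (hω 0))
  refine ENNReal.mul_pos (by simpa using hω 0) (ne_of_gt (lt_of_lt_of_le ?_
    (ENNReal.le_tsum (⟨0, le_rfl⟩ : {n : ℕ // ω 0 ≤ ω n}))))
  simpa using pow_pos (ha 0) 2

lemma ofReal_sq_eq_lintegral {w : ℝ} (hw : 0 ≤ w) :
    ENNReal.ofReal (w ^ 2) = ∫⁻ t in Set.Ioc 0 w, ENNReal.ofReal (2 * t) := by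
  rw [← ofReal_integral_eq_lintegral_ofReal]
  · rw [← intervalIntegral.integral_of_le hw, intervalIntegral.integral_const_mul, integral_id]
    congr 1; ring
  · exact (Continuous.integrableOn_Icc (by fun_prop)).mono_set Set.Ioc_subset_Icc_self
  · filter_upwards [ae_restrict_mem measurableSet_Ioc] with t ht
    have := ht.1
    positivity

/-- The measure with masses `a(n) ^ 2 ω(n) ^ 2` gives the sublevel set `{ω ≤ z}` mass at
most `2 z M`. -/
lemma tsum_sublevel_le {a ω : ℕ → ℝ} (hω : ∀ n, 0 < ω n) (z : ℝ) :
    ∑' n, {n | ω n ≤ z}.indicator (fun n => ENNReal.ofReal ((a n * ω n) ^ 2)) n ≤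
      2 * ENNReal.ofReal z * levelSup a ω := by
  have h1 : ∀ n, {n | ω n ≤ z}.indicator (fun n => ENNReal.ofReal ((a n * ω n) ^ 2)) n ≤
      ∫⁻ t in Set.Ioc 0 z, 2 * (ENNReal.ofReal t *
        {n | t ≤ ω n}.indicator (fun n => ENNReal.ofReal (a n ^ 2)) n) := by
    intro n
    by_cases hn : ω n ≤ z
    · rw [Set.indicator_of_mem (by exact hn), mul_pow, ENNReal.ofReal_mul (by positivity),
        ofReal_sq_eq_lintegral (hω n).le, ← lintegral_const_mul _ (by fun_prop)]
      refine le_trans (le_of_eq ?_) (lintegral_mono_set (Set.Ioc_subset_Ioc_right hn))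
      refine setLIntegral_congr_fun measurableSet_Ioc fun t ht => ?_
      rw [Set.indicator_of_mem (by exact ht.2), ENNReal.ofReal_mul (by norm_num)]
      simp only [ENNReal.ofReal_ofNat]
      ring
    · rw [Set.indicator_of_notMem (by exact hn)]
      exact zero_le
  refine (ENNReal.tsum_le_tsum h1).trans ?_
  rw [← lintegral_tsum]
  · have h2 : ∀ t ∈ Set.Ioc 0 z, ∑' n, 2 * (ENNReal.ofReal t *
        {n | t ≤ ω n}.indicator (fun n => ENNReal.ofReal (a n ^ 2)) n) ≤ 2 * levelSup a ω := by
      intro t ht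
      rw [ENNReal.tsum_mul_left, ENNReal.tsum_mul_left]
      gcongr
      refine le_trans ?_ (le_iSup₂ (f := fun (t : ℝ) (_ : 0 < t) => ENNReal.ofReal t *
        ∑' n : {n : ℕ // t ≤ ω n}, ENNReal.ofReal (a n ^ 2)) t ht.1)
      gcongr
      exact (tsum_subtype {n | t ≤ ω n} (fun n => ENNReal.ofReal (a n ^ 2))).ge
    refine (setLIntegral_mono measurable_const h2).trans ?_
    rw [setLIntegral_const, Real.volume_Ioc, sub_zero]
    exact le_of_eq (by ring)
  · intro n
    refine Measurable.aemeasurable ?_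
    refine Measurable.const_mul (Measurable.mul (by fun_prop) ?_) _
    exact Measurable.ite (p := fun t => t ≤ ω n) measurableSet_Iic measurable_const
      measurable_const

/-- The coefficient of `f` with respect to the `n`-th function of the system `u`. -/
def coeffOf {X : Type*} [MeasurableSpace X] (μ : Measure X) (u : ℕ → X → ℝ) (f : X → ℂ) (n : ℕ) :
    ℂ := ∫ x, f x * (u n x : ℂ) ∂μ

/-- An orthonormal system of real functions on a finite measure space, the `n`-th of which is
bounded almost everywhere by `K * a n`. -/
structure IsBoundedOrthonormal {X : Type*} [MeasurableSpace X] (μ : Measure X) (u : ℕ → X → ℝ)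
    (a : ℕ → ℝ) (K : ℝ≥0) : Prop where
  aestronglyMeasurable : ∀ n, AEStronglyMeasurable (u n) μ
  bound : ∀ n, ∀ᵐ x ∂μ, |u n x| ≤ K * a n
  orthonormal : ∀ n m, ∫ x, u n x * u m x ∂μ = if n = m then 1 else 0

section

variable {X : Type*} [MeasurableSpace X] {μ : Measure X} {u : ℕ → X → ℝ}
  {a : ℕ → ℝ} {K : ℝ≥0}

namespace IsBoundedOrthonormal

lemma memLp_top (hu : IsBoundedOrthonormal μ u a K) (n : ℕ) :
    MemLp (fun x => (u n x : ℂ)) ⊤ μ := by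
  refine memLp_top_of_bound
    (Complex.continuous_ofReal.comp_aestronglyMeasurable (hu.aestronglyMeasurable n)) (K * a n) ?_
  filter_upwards [hu.bound n] with x hx
  simpa using hx

lemma memLp [IsFiniteMeasure μ] (hu : IsBoundedOrthonormal μ u a K) (n : ℕ) (p : ℝ≥0∞) :
    MemLp (fun x => (u n x : ℂ)) p μ :=
  (hu.memLp_top n).mono_exponent le_top

lemma integrable_mul (hu : IsBoundedOrthonormal μ u a K) (n : ℕ) {f : X → ℂ}
    (hf : Integrable f μ) : Integrable (fun x => f x * (u n x : ℂ)) μ := by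
  refine hf.mul_bdd (c := K * a n) (hu.memLp_top n).1 ?_
  filter_upwards [hu.bound n] with x hx
  simpa using hx

lemma coeffOf_add (hu : IsBoundedOrthonormal μ u a K) (n : ℕ) {f g : X → ℂ}
    (hf : Integrable f μ) (hg : Integrable g μ) :
    coeffOf μ u (fun x => f x + g x) n = coeffOf μ u f n + coeffOf μ u g n := by
  unfold coeffOf
  rw [← integral_add (hu.integrable_mul n hf) (hu.integrable_mul n hg)]
  congr 1 with x
  ring

lemma enorm_coeffOf_le (hu : IsBoundedOrthonormal μ u a K) (n : ℕ) (f : X → ℂ) :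
    ‖coeffOf μ u f n‖ₑ ≤ K * ENNReal.ofReal (a n) * ∫⁻ x, ‖f x‖ₑ ∂μ := by
  refine (enorm_integral_le_lintegral_enorm _).trans ?_
  have hK : ENNReal.ofReal (K * a n) = K * ENNReal.ofReal (a n) := by
    rw [ENNReal.ofReal_mul K.coe_nonneg, ENNReal.ofReal_coe_nnreal]
  rw [← hK, ← lintegral_const_mul' _ _ ENNReal.ofReal_ne_top]
  refine lintegral_mono_ae ?_
  filter_upwards [hu.bound n] with x hx
  rw [enorm_mul, mul_comm]
  gcongr
  rw [← ofReal_norm]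
  exact ENNReal.ofReal_le_ofReal (by simpa using hx)

/-- Bessel's inequality. -/
lemma tsum_enorm_coeffOf_sq_le [IsFiniteMeasure μ] (hu : IsBoundedOrthonormal μ u a K) {f : X → ℂ}
    (hf : MemLp f 2 μ) : ∑' n, ‖coeffOf μ u f n‖ₑ ^ 2 ≤ ∫⁻ x, ‖f x‖ₑ ^ 2 ∂μ := by
  let v : ℕ → Lp ℂ 2 μ := fun n => (hu.memLp n 2).toLp
  have hinner : ∀ n (g : X → ℂ) (hg : MemLp g 2 μ), inner ℂ (v n) hg.toLp = coeffOf μ u g n := by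
    intro n g hg
    rw [L2.inner_def]
    refine integral_congr_ae ?_
    filter_upwards [hg.coeFn_toLp, (hu.memLp n 2).coeFn_toLp] with x h1 h2
    rw [h1, h2]
    simp [RCLike.inner_apply]
  have hv : Orthonormal ℂ v := by
    rw [orthonormal_iff_ite]
    intro i j
    rw [hinner]
    unfold coeffOf
    have := hu.orthonormal j i
    rw [show (fun x => ((u j x : ℂ)) * (u i x : ℂ)) = fun x => ((u j x * u i x : ℝ) : ℂ) by
      ext x; push_cast; rfl, integral_complex_ofReal, this]
    simp only [eq_comm (a := j)]
    split_ifs <;> simp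
  have hb := hv.tsum_inner_products_le hf.toLp
  have hs := hv.inner_products_summable hf.toLp
  simp only [hinner] at hb hs
  have e1 : ∑' n, ‖coeffOf μ u f n‖ₑ ^ 2 = ENNReal.ofReal (∑' n, ‖coeffOf μ u f n‖ ^ 2) := by
    rw [ENNReal.ofReal_tsum_of_nonneg (fun n => by positivity) hs]
    congr 1 with n
    rw [ENNReal.ofReal_pow (norm_nonneg _), ofReal_norm]
  rw [e1]
  refine (ENNReal.ofReal_le_ofReal hb).trans (le_of_eq ?_)
  rw [ENNReal.ofReal_pow (norm_nonneg _), Lp.norm_toLp, ENNReal.ofReal_toReal hf.2.ne,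
    eLpNorm_eq_lintegral_rpow_enorm_toReal (by norm_num) (by norm_num)]
  rw [← ENNReal.rpow_natCast, ← ENNReal.rpow_mul]
  simp

end IsBoundedOrthonormal

end

/-! ### Interpolation between the weak type estimates -/

lemma lintegral_rpow_below_le {F m p : ℝ} (hF : 0 ≤ F) (hm : 0 < m) (hp : 1 < p) :
    ∫⁻ y in Set.Ioi (0 : ℝ),
        (if m * y < F then ENNReal.ofReal (y ^ (p - 2)) * ENNReal.ofReal F else 0) ≤
      ENNReal.ofReal (m ^ (1 - p) / (p - 1) * F ^ p) := by
  have h0 : 0 ≤ F / m := by positivity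
  have h1 : ∫⁻ y in Set.Ioi (0 : ℝ),
        (if m * y < F then ENNReal.ofReal (y ^ (p - 2)) * ENNReal.ofReal F else 0) ≤
      ∫⁻ y in Set.Ioc 0 (F / m), ENNReal.ofReal (y ^ (p - 2)) * ENNReal.ofReal F := by
    rw [← lintegral_indicator measurableSet_Ioi, ← lintegral_indicator measurableSet_Ioc]
    refine lintegral_mono fun y => ?_
    by_cases hy : 0 < y
    · rw [Set.indicator_of_mem (by exact hy)]
      split_ifs with h
      · rw [Set.indicator_of_mem]
        exact ⟨hy, by rw [le_div_iff₀ hm]; linarith⟩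
      · exact zero_le
    · rw [Set.indicator_of_notMem (by exact hy)]
      exact zero_le
  refine h1.trans ?_
  rw [lintegral_mul_const _ (by fun_prop), ← ofReal_integral_eq_lintegral_ofReal,
    ← intervalIntegral.integral_of_le h0, integral_rpow (Or.inl (by linarith)),
    ← ENNReal.ofReal_mul']
  · refine ENNReal.ofReal_le_ofReal (le_of_eq ?_)
    rcases hF.eq_or_lt with rfl | hF
    · rw [Real.zero_rpow (by linarith : p ≠ 0)]; simp
    · rw [show p - 2 + 1 = p - 1 by ring, Real.zero_rpow (by linarith), Real.div_rpow hF.le hm.le,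
        show 1 - p = -(p - 1) by ring, Real.rpow_neg hm.le, Real.rpow_sub_one hF.ne' p]
      field_simp
      ring
  · exact hF
  · exact (intervalIntegrable_iff_integrableOn_Ioc_of_le h0).1
      (intervalIntegral.intervalIntegrable_rpow' (by linarith))
  · filter_upwards [ae_restrict_mem measurableSet_Ioc] with t ht
    exact Real.rpow_nonneg ht.1.le _

lemma lintegral_rpow_above_le {F m p : ℝ} (hF : 0 ≤ F) (hm : 0 < m) (hp : p < 2) :
    ∫⁻ y in Set.Ioi (0 : ℝ),
        (if m * y < F then 0 else ENNReal.ofReal (y ^ (p - 3)) * ENNReal.ofReal (F ^ 2)) ≤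
      ENNReal.ofReal (m ^ (2 - p) / (2 - p) * F ^ p) := by
  rcases hF.eq_or_lt with rfl | hF
  · simp
  have h0 : 0 < F / m := by positivity
  have h1 : ∫⁻ y in Set.Ioi (0 : ℝ),
        (if m * y < F then 0 else ENNReal.ofReal (y ^ (p - 3)) * ENNReal.ofReal (F ^ 2)) ≤
      ∫⁻ y in Set.Ici (F / m), ENNReal.ofReal (y ^ (p - 3)) * ENNReal.ofReal (F ^ 2) := by
    rw [← lintegral_indicator measurableSet_Ioi, ← lintegral_indicator measurableSet_Ici]
    refine lintegral_mono fun y => ?_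
    by_cases hy : 0 < y
    · rw [Set.indicator_of_mem (by exact hy)]
      split_ifs with h
      · exact zero_le
      · rw [Set.indicator_of_mem]
        rw [Set.mem_Ici, div_le_iff₀ hm]; linarith
    · rw [Set.indicator_of_notMem (by exact hy)]
      exact zero_le
  refine h1.trans ?_
  rw [setLIntegral_congr Ioi_ae_eq_Ici.symm,
    lintegral_mul_const _ (by fun_prop), ← ofReal_integral_eq_lintegral_ofReal,
    integral_Ioi_rpow_of_lt (by linarith) h0, ← ENNReal.ofReal_mul']
  · refine ENNReal.ofReal_le_ofReal (le_of_eq ?_)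
    have h2 : p - 2 ≠ 0 := by linarith
    have h3 : 2 - p ≠ 0 := by linarith
    rw [show p - 3 + 1 = p - 2 by ring, Real.div_rpow hF.le hm.le,
        show 2 - p = -(p - 2) by ring, Real.rpow_neg hm.le, Real.rpow_sub hF p 2, Real.rpow_two]
    field_simp
  · positivity
  · exact integrableOn_Ioi_rpow_of_lt (by linarith) h0
  · filter_upwards [ae_restrict_mem measurableSet_Ioi] with t ht
    exact Real.rpow_nonneg (h0.trans ht).le _

/-- The measure on `ℕ` with mass `d(n) ^ 2` at `n`. -/
def massMeasure (d : ℕ → ℝ) : Measure ℕ :=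
  Measure.count.withDensity fun n => ENNReal.ofReal (d n ^ 2)

lemma lintegral_massMeasure (d : ℕ → ℝ) (g : ℕ → ℝ≥0∞) :
    ∫⁻ n, g n ∂massMeasure d = ∑' n, ENNReal.ofReal (d n ^ 2) * g n := by
  rw [massMeasure, lintegral_withDensity_eq_lintegral_mul _ measurable_from_top
    measurable_from_top, lintegral_count]
  rfl

lemma massMeasure_apply (d : ℕ → ℝ) (s : Set ℕ) :
    massMeasure d s = ∑' n, s.indicator (fun n => ENNReal.ofReal (d n ^ 2)) n := by
  rw [massMeasure, withDensity_apply _ (MeasurableSet.of_discrete),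
    ← lintegral_indicator MeasurableSet.of_discrete, lintegral_count]

section

variable {X : Type*} [MeasurableSpace X] {μ : Measure X} {u : ℕ → X → ℝ}
  {a ω : ℕ → ℝ} {K : ℝ≥0}

namespace IsBoundedOrthonormal

/-- The map `f ↦ (c_n(f) / (a_n ω_n))` is of weak type `(1, 1)`. -/
lemma massMeasure_lt_le (hu : IsBoundedOrthonormal μ u a K) (ha : ∀ n, 0 < a n)
    (hω : ∀ n, 0 < ω n) {f : X → ℂ} (hf : Integrable f μ) {y : ℝ} (hy : 0 < y) :
    massMeasure (fun n => a n * ω n) {n | y < ‖coeffOf μ u f n‖ / (a n * ω n)} ≤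
      2 * K * levelSup a ω * ENNReal.ofReal y⁻¹ * ∫⁻ x, ‖f x‖ₑ ∂μ := by
  have hfin : ∫⁻ x, ‖f x‖ₑ ∂μ ≠ ⊤ := hf.2.ne
  have hsub : {n | y < ‖coeffOf μ u f n‖ / (a n * ω n)} ⊆
      {n | ω n ≤ K * y⁻¹ * (∫⁻ x, ‖f x‖ₑ ∂μ).toReal} := by
    intro n hn
    simp only [Set.mem_ofPred_eq] at hn ⊢
    rw [lt_div_iff₀ (mul_pos (ha n) (hω n))] at hn
    have h1 := ENNReal.toReal_mono (by finiteness) (hu.enorm_coeffOf_le n f)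
    simp only [toReal_enorm, ENNReal.toReal_mul, ENNReal.coe_toReal,
      ENNReal.toReal_ofReal (ha n).le] at h1
    have h2 : a n * (y * ω n) ≤ a n * (K * (∫⁻ x, ‖f x‖ₑ ∂μ).toReal) := by
      calc _ = y * (a n * ω n) := by ring
        _ ≤ _ := hn.le.trans h1
        _ = _ := by ring
    have h3 := le_of_mul_le_mul_left h2 (ha n)
    calc ω n = y⁻¹ * (y * ω n) := by field_simp
      _ ≤ y⁻¹ * (K * (∫⁻ x, ‖f x‖ₑ ∂μ).toReal) := by gcongr
      _ = _ := by ring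
  refine (measure_mono hsub).trans ?_
  rw [massMeasure_apply]
  refine (tsum_sublevel_le hω _).trans (le_of_eq ?_)
  rw [ENNReal.ofReal_mul (by positivity), ENNReal.ofReal_mul (by positivity),
    ENNReal.ofReal_coe_nnreal, ENNReal.ofReal_toReal hfin]
  ring

/-- The map `f ↦ (c_n(f) / (a_n ω_n))` is of weak type `(2, 2)`. -/
lemma massMeasure_lt_le_sq [IsFiniteMeasure μ] (hu : IsBoundedOrthonormal μ u a K)
    (ha : ∀ n, 0 < a n) (hω : ∀ n, 0 < ω n) {f : X → ℂ} (hf : MemLp f 2 μ) {y : ℝ} (hy : 0 < y) :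
    massMeasure (fun n => a n * ω n) {n | y < ‖coeffOf μ u f n‖ / (a n * ω n)} ≤
      ENNReal.ofReal y⁻¹ ^ 2 * ∫⁻ x, ‖f x‖ₑ ^ 2 ∂μ := by
  rw [massMeasure_apply]
  refine le_trans ?_ (mul_le_mul_right (hu.tsum_enorm_coeffOf_sq_le hf) _)
  rw [← ENNReal.tsum_mul_left]
  refine ENNReal.tsum_le_tsum fun n => ?_
  refine Set.indicator_apply_le' (fun hn => ?_) (fun _ => zero_le)
  simp only [Set.mem_ofPred_eq] at hn
  have hd := mul_pos (ha n) (hω n)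
  rw [lt_div_iff₀ hd] at hn
  rw [← ofReal_norm, ← mul_pow, ← ENNReal.ofReal_mul (by positivity),
    ← ENNReal.ofReal_pow (by positivity)]
  refine ENNReal.ofReal_le_ofReal (pow_le_pow_left₀ hd.le ?_ 2)
  rw [inv_mul_eq_div, le_div_iff₀ hy]
  linarith

/-- Paley's inequality for `1 < p < 2`: the Marcinkiewicz interpolation of the two weak type
estimates, with the function cut at the height `M y` at level `y`, `M = levelSup a ω`. -/
lemma tsum_rpow_le_of_measurable [IsFiniteMeasure μ] (hu : IsBoundedOrthonormal μ u a K)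
    (ha : ∀ n, 0 < a n) (hω : ∀ n, 0 < ω n) (hM : levelSup a ω < ⊤) {p : ℝ} (hp : 1 < p)
    (hp2 : p < 2) {f : X → ℂ} (hf : Measurable f) (hfp : MemLp f (ENNReal.ofReal p) μ) :
    ∑' n, ENNReal.ofReal ((a n * ω n) ^ (2 - p) * ‖coeffOf μ u f n‖ ^ p) ≤
      ENNReal.ofReal (p * (4 * K / (p - 1) + 4 / (2 - p))) * levelSup a ω ^ (2 - p) *
        ∫⁻ x, ENNReal.ofReal (‖f x‖ ^ p) ∂μ := by
  set M := levelSup a ω with hMdef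
  set m := M.toReal with hmdef
  have hm : 0 < m := ENNReal.toReal_pos (levelSup_pos ha hω).ne' hM.ne
  have hMm : M = ENNReal.ofReal m := (ENNReal.ofReal_toReal hM.ne).symm
  have hd : ∀ n, 0 < a n * ω n := fun n => mul_pos (ha n) (hω n)
  have hp0 : 0 < p := by linarith
  have hfi : Integrable f μ := hfp.integrable (by simpa using hp.le)
  -- The part of `f` above height `m y` and the part below.
  let b : ℝ → X → ℂ := fun y x => if m * y < ‖f x‖ then f x else 0
  let s : ℝ → X → ℂ := fun y x => if m * y < ‖f x‖ then 0 else f x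
  have hset : ∀ y, MeasurableSet {x | m * y < ‖f x‖} := fun y =>
    measurableSet_lt measurable_const hf.norm
  have hb : ∀ y, Measurable (b y) := fun y => Measurable.ite (hset y) hf measurable_const
  have hs : ∀ y, Measurable (s y) := fun y => Measurable.ite (hset y) measurable_const hf
  have hbi : ∀ y, Integrable (b y) μ := fun y => hfi.mono (hb y).aestronglyMeasurable
    (Eventually.of_forall fun x => by simp only [b]; split_ifs <;> simp)
  have hsi : ∀ y, Integrable (s y) μ := fun y => hfi.mono (hs y).aestronglyMeasurable
    (Eventually.of_forall fun x => by simp only [s]; split_ifs <;> simp)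
  have hs2 : ∀ y, 0 < y → MemLp (s y) 2 μ := fun y hy =>
    (memLp_top_of_bound (hs y).aestronglyMeasurable (m * y) (Eventually.of_forall fun x => by
      simp only [s]
      split_ifs with h
      · simpa using (mul_pos hm hy).le
      · exact not_lt.1 h)).mono_exponent le_top
  have hlevel : ∀ y ∈ Set.Ioi (0 : ℝ),
      massMeasure (fun n => a n * ω n) {n | y < ‖coeffOf μ u f n‖ / (a n * ω n)} *
          ENNReal.ofReal (y ^ (p - 1)) ≤
        4 * K * M * (∫⁻ x, (if m * y < ‖f x‖ then
          ENNReal.ofReal (y ^ (p - 2)) * ENNReal.ofReal ‖f x‖ else 0) ∂μ) +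
        4 * ∫⁻ x, (if m * y < ‖f x‖ then 0 else
          ENNReal.ofReal (y ^ (p - 3)) * ENNReal.ofReal (‖f x‖ ^ 2)) ∂μ := by
    intro y hy
    have hy : 0 < y := hy
    have hsub : {n | y < ‖coeffOf μ u f n‖ / (a n * ω n)} ⊆
        {n | y / 2 < ‖coeffOf μ u (b y) n‖ / (a n * ω n)} ∪
        {n | y / 2 < ‖coeffOf μ u (s y) n‖ / (a n * ω n)} := by
      intro n hn
      simp only [Set.mem_ofPred_eq, Set.mem_union] at hn ⊢
      by_contra! hcon
      have hsum : coeffOf μ u f n = coeffOf μ u (b y) n + coeffOf μ u (s y) n := by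
        rw [← hu.coeffOf_add n (hbi y) (hsi y)]
        congr 1 with x
        simp only [b, s]
        split_ifs <;> simp
      have : ‖coeffOf μ u f n‖ / (a n * ω n) ≤
          ‖coeffOf μ u (b y) n‖ / (a n * ω n) + ‖coeffOf μ u (s y) n‖ / (a n * ω n) := by
        rw [← add_div, hsum]
        exact div_le_div_of_nonneg_right (norm_add_le _ _) (hd n).le
      linarith [hcon.1, hcon.2]
    have h1 := (measure_mono hsub).trans ((measure_union_le _ _).trans (add_le_add
      (hu.massMeasure_lt_le ha hω (hbi y) (half_pos hy))
      (hu.massMeasure_lt_le_sq ha hω (hs2 y hy) (half_pos hy))))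
    refine (mul_le_mul_left h1 _).trans (le_of_eq ?_)
    rw [add_mul]
    have e2 : ENNReal.ofReal (y / 2)⁻¹ = 2 * ENNReal.ofReal y⁻¹ := by
      rw [show (y / 2)⁻¹ = 2 * y⁻¹ by field_simp, ENNReal.ofReal_mul (by norm_num)]
      simp
    have ep1 : ENNReal.ofReal y⁻¹ * ENNReal.ofReal (y ^ (p - 1)) =
        ENNReal.ofReal (y ^ (p - 2)) := by
      rw [← ENNReal.ofReal_mul (by positivity), ← Real.rpow_neg_one, ← Real.rpow_add hy]
      congr 2; ring
    have ep2 : ENNReal.ofReal y⁻¹ ^ 2 * ENNReal.ofReal (y ^ (p - 1)) =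
        ENNReal.ofReal (y ^ (p - 3)) := by
      rw [sq, mul_assoc, ep1, ← ENNReal.ofReal_mul (by positivity), ← Real.rpow_neg_one,
        ← Real.rpow_add hy]
      congr 2; ring
    have i1 : ∫⁻ x, (if m * y < ‖f x‖ then
          ENNReal.ofReal (y ^ (p - 2)) * ENNReal.ofReal ‖f x‖ else 0) ∂μ =
        ENNReal.ofReal (y ^ (p - 2)) * ∫⁻ x, ‖b y x‖ₑ ∂μ := by
      rw [← lintegral_const_mul' _ _ ENNReal.ofReal_ne_top]
      refine lintegral_congr fun x => ?_
      simp only [b]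
      split_ifs <;> simp
    have i2 : ∫⁻ x, (if m * y < ‖f x‖ then 0 else
          ENNReal.ofReal (y ^ (p - 3)) * ENNReal.ofReal (‖f x‖ ^ 2)) ∂μ =
        ENNReal.ofReal (y ^ (p - 3)) * ∫⁻ x, ‖s y x‖ₑ ^ 2 ∂μ := by
      rw [← lintegral_const_mul' _ _ ENNReal.ofReal_ne_top]
      refine lintegral_congr fun x => ?_
      simp only [s]
      split_ifs <;> simp [ENNReal.ofReal_pow]
    rw [i1, i2, ← ep1, ← ep2, e2]
    ring
  have hmeas2 : Measurable (Function.uncurry fun (y : ℝ) (x : X) => if m * y < ‖f x‖ then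
      ENNReal.ofReal (y ^ (p - 2)) * ENNReal.ofReal ‖f x‖ else 0) := by
    refine Measurable.ite (measurableSet_lt (by fun_prop) (by fun_prop)) (by fun_prop)
      measurable_const
  have hmeas3 : Measurable (Function.uncurry fun (y : ℝ) (x : X) => if m * y < ‖f x‖ then 0 else
      ENNReal.ofReal (y ^ (p - 3)) * ENNReal.ofReal (‖f x‖ ^ 2)) := by
    refine Measurable.ite (measurableSet_lt (by fun_prop) (by fun_prop)) measurable_const
      (by fun_prop)
  have hI2 : Measurable fun y : ℝ => ∫⁻ x, (if m * y < ‖f x‖ then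
      ENNReal.ofReal (y ^ (p - 2)) * ENNReal.ofReal ‖f x‖ else 0) ∂μ :=
    hmeas2.lintegral_prod_right'
  have hI3 : Measurable fun y : ℝ => ∫⁻ x, (if m * y < ‖f x‖ then 0 else
      ENNReal.ofReal (y ^ (p - 3)) * ENNReal.ofReal (‖f x‖ ^ 2)) ∂μ :=
    hmeas3.lintegral_prod_right'
  have hlayer : ∑' n, ENNReal.ofReal ((a n * ω n) ^ (2 - p) * ‖coeffOf μ u f n‖ ^ p) =
      ENNReal.ofReal p * ∫⁻ y in Set.Ioi 0,
        massMeasure (fun n => a n * ω n) {n | y < ‖coeffOf μ u f n‖ / (a n * ω n)} *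
          ENNReal.ofReal (y ^ (p - 1)) := by
    rw [← lintegral_rpow_eq_lintegral_meas_lt_mul _
      (Eventually.of_forall fun n => div_nonneg (norm_nonneg _) (hd n).le)
      (measurable_from_top.aemeasurable) hp0, lintegral_massMeasure]
    congr 1 with n
    rw [← ENNReal.ofReal_mul (by positivity), Real.div_rpow (norm_nonneg _) (hd n).le,
      Real.rpow_sub (hd n), Real.rpow_two]
    congr 1
    ring
  rw [hlayer]
  have hint : ∫⁻ y in Set.Ioi (0 : ℝ),
        massMeasure (fun n => a n * ω n) {n | y < ‖coeffOf μ u f n‖ / (a n * ω n)} *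
          ENNReal.ofReal (y ^ (p - 1)) ≤
      4 * K * M * ∫⁻ x, ENNReal.ofReal (m ^ (1 - p) / (p - 1) * ‖f x‖ ^ p) ∂μ +
      4 * ∫⁻ x, ENNReal.ofReal (m ^ (2 - p) / (2 - p) * ‖f x‖ ^ p) ∂μ := by
    refine (setLIntegral_mono' measurableSet_Ioi hlevel).trans ?_
    rw [lintegral_add_left (hI2.const_mul _),
      lintegral_const_mul _ hI2,
      lintegral_const_mul _ hI3,
      lintegral_lintegral_swap hmeas2.aemeasurable, lintegral_lintegral_swap hmeas3.aemeasurable]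
    gcongr with x x
    · exact lintegral_rpow_below_le (norm_nonneg _) hm hp
    · exact lintegral_rpow_above_le (norm_nonneg _) hm hp2
  refine (mul_le_mul_right hint _).trans (le_of_eq ?_)
  have hc1 : 0 ≤ m ^ (1 - p) / (p - 1) := div_nonneg (by positivity) (by linarith)
  have hc2 : 0 ≤ m ^ (2 - p) / (2 - p) := div_nonneg (by positivity) (by linarith)
  simp only [ENNReal.ofReal_mul hc1, ENNReal.ofReal_mul hc2]
  rw [lintegral_const_mul' _ _ ENNReal.ofReal_ne_top,
    lintegral_const_mul' _ _ ENNReal.ofReal_ne_top, ← mul_assoc, ← mul_assoc, ← add_mul,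
    ← mul_assoc]
  congr 1
  rw [hMm, ENNReal.ofReal_rpow_of_pos hm, ← ENNReal.ofReal_mul (mul_nonneg hp0.le (add_nonneg
    (div_nonneg (by positivity) (by linarith)) (div_nonneg (by positivity) (by linarith)))),
    ← ENNReal.ofReal_coe_nnreal, show (4 : ℝ≥0∞) = ENNReal.ofReal 4 by simp,
    ← ENNReal.ofReal_mul (by norm_num), ← ENNReal.ofReal_mul (by positivity),
    ← ENNReal.ofReal_mul (by positivity), ← ENNReal.ofReal_mul (by positivity),
    ← ENNReal.ofReal_add (by positivity) (by positivity), ← ENNReal.ofReal_mul (by positivity)]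
  congr 1
  have e : m ^ (2 - p) = m * m ^ (1 - p) := by
    rw [show 2 - p = 1 + (1 - p) by ring, Real.rpow_add hm, Real.rpow_one]
  rw [e]
  ring

end IsBoundedOrthonormal

end

/-! ### Paley's inequality and its dual -/

lemma expDiff_eq {p : ℝ} (hp : p ≠ 0) : expDiff p = 2 / p - 1 := by
  unfold expDiff Real.conjExponent
  rw [one_div_div, sub_div, div_self hp]
  ring

/-- The constant in Paley's inequality for a system bounded by `K * a n`. -/
def paleyConstant (K : ℝ≥0) (p : ℝ) : ℝ≥0 :=
  if p < 2 then (p * (4 * K / (p - 1) + 4 / (2 - p))).toNNReal ^ (1 / p) else 1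

section

variable {X : Type*} [MeasurableSpace X] {μ : Measure X} [IsFiniteMeasure μ] {u : ℕ → X → ℝ}
  {a ω : ℕ → ℝ} {K : ℝ≥0}

namespace IsBoundedOrthonormal

/-- Paley's inequality for an orthonormal system of bounded functions. -/
theorem paley (hu : IsBoundedOrthonormal μ u a K)
    (ha : ∀ n, 0 < a n) (hω : ∀ n, 0 < ω n) (hM : levelSup a ω < ⊤) {p : ℝ} (hp : 1 < p)
    (hp2 : p ≤ 2) {f : X → ℂ} (hfp : MemLp f (ENNReal.ofReal p) μ) :
    (∑' n, ENNReal.ofReal (((a n * ω n) ^ expDiff p * ‖coeffOf μ u f n‖) ^ p)) ^ (1 / p) ≤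
      paleyConstant K p * levelSup a ω ^ expDiff p * eLpNorm f (ENNReal.ofReal p) μ := by
  have hp0 : 0 < p := by linarith
  have hd : ∀ n, 0 < a n * ω n := fun n => mul_pos (ha n) (hω n)
  have he : expDiff p * p = 2 - p := by
    rw [expDiff_eq hp0.ne']; field_simp
  have hterm : ∀ n, ((a n * ω n) ^ expDiff p * ‖coeffOf μ u f n‖) ^ p =
      (a n * ω n) ^ (2 - p) * ‖coeffOf μ u f n‖ ^ p := fun n => by
    rw [Real.mul_rpow (Real.rpow_nonneg (hd n).le _) (norm_nonneg _),
      ← Real.rpow_mul (hd n).le, he]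
  simp only [hterm]
  rcases hp2.lt_or_eq with hp2 | rfl
  · let g : X → ℂ := hfp.1.mk f
    have hg : Measurable g := hfp.1.stronglyMeasurable_mk.measurable
    have hfg : f =ᵐ[μ] g := hfp.1.ae_eq_mk
    have hc : ∀ n, coeffOf μ u f n = coeffOf μ u g n := fun n => integral_congr_ae (by
      filter_upwards [hfg] with x hx
      rw [hx])
    have hgp : MemLp g (ENNReal.ofReal p) μ := (memLp_congr_ae hfg).1 hfp
    have hmain := hu.tsum_rpow_le_of_measurable ha hω hM hp hp2 hg hgp
    have hnorm : eLpNorm g (ENNReal.ofReal p) μ =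
        (∫⁻ x, ENNReal.ofReal (‖g x‖ ^ p) ∂μ) ^ (1 / p) := by
      rw [eLpNorm_eq_lintegral_rpow_enorm_toReal (by simpa using hp0) ENNReal.ofReal_ne_top,
        ENNReal.toReal_ofReal hp0.le]
      congr 2 with x
      rw [← ENNReal.ofReal_rpow_of_nonneg (norm_nonneg _) hp0.le, ofReal_norm]
    simp only [hc]
    rw [eLpNorm_congr_ae hfg, hnorm]
    refine (ENNReal.rpow_le_rpow hmain (by positivity)).trans (le_of_eq ?_)
    rw [ENNReal.mul_rpow_of_nonneg _ _ (by positivity),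
      ENNReal.mul_rpow_of_nonneg _ _ (by positivity), ← ENNReal.rpow_mul, paleyConstant,
      if_pos hp2, show (2 - p) * (1 / p) = expDiff p by rw [← he]; field_simp,
      ENNReal.coe_rpow_of_nonneg _ (by positivity)]
    rfl
  · have he0 : expDiff 2 = 0 := by rw [expDiff_eq (by norm_num)]; norm_num
    have hfp' : MemLp f 2 μ := by simpa using hfp
    rw [he0, paleyConstant, if_neg (lt_irrefl _)]
    have := ENNReal.rpow_le_rpow (hu.tsum_enorm_coeffOf_sq_le hfp')
      (z := 1 / 2) (by positivity)
    have hnorm : eLpNorm f (ENNReal.ofReal 2) μ = (∫⁻ x, ‖f x‖ₑ ^ 2 ∂μ) ^ (1 / 2 : ℝ) := by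
      rw [eLpNorm_eq_lintegral_rpow_enorm_toReal (by simp) ENNReal.ofReal_ne_top]
      simp
    rw [hnorm]
    simp only [sub_self, Real.rpow_zero, one_mul, ENNReal.rpow_zero, ENNReal.coe_one]
    convert this using 4 with n
    rw [Real.rpow_two, ENNReal.ofReal_pow (norm_nonneg _), ofReal_norm]

/-- The dual of Paley's inequality for finite sums `Φ`, by testing `Φ` against
`|Φ| ^ (q - 2) Φ`. -/
lemma eLpNorm_sum_le (hu : IsBoundedOrthonormal μ u a K)
    (ha : ∀ n, 0 < a n) (hω : ∀ n, 0 < ω n) (hM : levelSup a ω < ⊤) {q : ℝ} (hq : 2 ≤ q)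
    (φ : ℕ → ℝ) (s : Finset ℕ) :
    eLpNorm (fun x => ((∑ n ∈ s, φ n * u n x : ℝ) : ℂ)) (ENNReal.ofReal q) μ ≤
      paleyConstant K (Real.conjExponent q) * levelSup a ω ^ expDiff (Real.conjExponent q) *
        (∑ n ∈ s, ENNReal.ofReal (((a n * ω n) ^ expDiff q * ‖(φ n : ℂ)‖) ^ q)) ^ (1 / q) := by
  have hq0 : 0 < q := by linarith
  have hpq : q.HolderConjugate (Real.conjExponent q) := .conjExponent (by linarith)
  set p := Real.conjExponent q with hpdef
  have hp1 : 1 < p := hpq.symm.lt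
  have hp0 : 0 < p := by linarith
  have hp2 : p ≤ 2 := by
    rw [hpdef, Real.conjExponent, div_le_iff₀ (by linarith)]; linarith
  have hd : ∀ n, 0 < a n * ω n := fun n => mul_pos (ha n) (hω n)
  have hneg : expDiff q = - expDiff p := by
    have h : p.conjExponent = q := hpq.symm.conjugate_eq.symm
    rw [expDiff, expDiff, ← hpdef, h]; ring
  let Φ : X → ℝ := fun x => ∑ n ∈ s, φ n * u n x
  have hΦm : AEStronglyMeasurable Φ μ := by
    refine Finset.aestronglyMeasurable_fun_sum _ fun n _ => ?_
    exact (hu.aestronglyMeasurable n).const_mul _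
  let g : X → ℂ := fun x => ((|Φ x| ^ (q - 2) * Φ x : ℝ) : ℂ)
  have hgm : AEStronglyMeasurable g μ := by
    refine Complex.continuous_ofReal.comp_aestronglyMeasurable (AEStronglyMeasurable.mul ?_ hΦm)
    exact (Real.continuous_rpow_const (by linarith)).comp_aestronglyMeasurable hΦm.norm
  obtain ⟨C, hC⟩ : ∃ C : ℝ, ∀ᵐ x ∂μ, |Φ x| ≤ C := by
    refine ⟨∑ n ∈ s, |φ n| * (K * a n), ?_⟩
    filter_upwards [ae_all_iff.2 hu.bound] with x hx
    refine (Finset.abs_sum_le_sum_abs _ _).trans (Finset.sum_le_sum fun n _ => ?_)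
    rw [abs_mul]
    exact mul_le_mul_of_nonneg_left (hx n) (abs_nonneg _)
  have hgnorm : ∀ x, ‖g x‖ = |Φ x| ^ (q - 1) := by
    intro x
    rw [Complex.norm_real, Real.norm_eq_abs, abs_mul, abs_of_nonneg (by positivity)]
    rcases eq_or_ne (Φ x) 0 with h | h
    · rw [h]
      simp [Real.zero_rpow (show q - 1 ≠ 0 by linarith)]
    · nth_rewrite 2 [← Real.rpow_one |Φ x|]
      rw [← Real.rpow_add (abs_pos.2 h)]
      congr 1; ring
  have hgtop : MemLp g ⊤ μ := by
    refine memLp_top_of_bound hgm (C ^ (q - 1)) ?_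
    filter_upwards [hC] with x hx
    rw [hgnorm]
    exact Real.rpow_le_rpow (abs_nonneg _) hx (by linarith)
  have hgp : MemLp g (ENNReal.ofReal p) μ := hgtop.mono_exponent le_top
  have hgi : Integrable g μ := memLp_one_iff_integrable.1 (hgtop.mono_exponent le_top)
  have hΦq : ∀ x, |Φ x| ^ q = Φ x * (|Φ x| ^ (q - 2) * Φ x) := by
    intro x
    rw [show Φ x * (|Φ x| ^ (q - 2) * Φ x) = |Φ x| ^ (q - 2) * |Φ x| ^ 2 by rw [sq_abs]; ring]
    rcases eq_or_ne (Φ x) 0 with h | h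
    · rw [h]
      simp [Real.zero_rpow hq0.ne']
    · rw [← Real.rpow_natCast, ← Real.rpow_add (abs_pos.2 h)]
      congr 1; push_cast; ring
  set N : ℝ≥0∞ := ∫⁻ x, ‖Φ x‖ₑ ^ q ∂μ with hN
  have henorm : ∀ x, ‖Φ x‖ₑ ^ q = ENNReal.ofReal (|Φ x| ^ q) := fun x => by
    rw [← ENNReal.ofReal_rpow_of_nonneg (abs_nonneg _) hq0.le, ← Real.norm_eq_abs, ofReal_norm]
  have hNtop : N ≠ ⊤ := by
    refine ne_of_lt (lt_of_le_of_lt (lintegral_mono_ae (g := fun _ => ENNReal.ofReal (C ^ q)) ?_)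
      ?_)
    · filter_upwards [hC] with x hx
      rw [henorm]
      exact ENNReal.ofReal_le_ofReal (Real.rpow_le_rpow (abs_nonneg _) hx hq0.le)
    · rw [lintegral_const]
      finiteness
  have hΦnorm : eLpNorm (fun x => ((∑ n ∈ s, φ n * u n x : ℝ) : ℂ)) (ENNReal.ofReal q) μ =
      N ^ (1 / q) := by
    rw [eLpNorm_eq_lintegral_rpow_enorm_toReal (by simpa using hq0) ENNReal.ofReal_ne_top,
      ENNReal.toReal_ofReal hq0.le, hN]
    congr 2 with x
    congr 1
    rw [← ofReal_norm, ← ofReal_norm, Complex.norm_real]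
  have hgpnorm : eLpNorm g (ENNReal.ofReal p) μ = N ^ (1 / p) := by
    rw [eLpNorm_eq_lintegral_rpow_enorm_toReal (by simpa using hp0) ENNReal.ofReal_ne_top,
      ENNReal.toReal_ofReal hp0.le, hN]
    congr 2 with x
    rw [henorm, ← ofReal_norm, hgnorm, ENNReal.ofReal_rpow_of_nonneg (by positivity) hp0.le,
      ← Real.rpow_mul (abs_nonneg _), hpq.sub_one_mul_conj]
  have hpair : N ≤ ∑ n ∈ s, ‖φ n‖ₑ * ‖coeffOf μ u g n‖ₑ := by
    have e1 : ((∫ x, |Φ x| ^ q ∂μ : ℝ) : ℂ) = ∑ n ∈ s, (φ n : ℂ) * coeffOf μ u g n := by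
      rw [← integral_complex_ofReal]
      simp only [coeffOf, ← integral_const_mul]
      rw [← integral_finsetSum _ fun n _ => (hu.integrable_mul n hgi).const_mul _]
      refine integral_congr_ae (Eventually.of_forall fun x => ?_)
      simp only [hΦq, g]
      conv_lhs => rw [show Φ x * (|Φ x| ^ (q - 2) * Φ x) =
        (∑ n ∈ s, φ n * u n x) * (|Φ x| ^ (q - 2) * Φ x) from rfl, Finset.sum_mul]
      push_cast
      exact Finset.sum_congr rfl fun n _ => by ring
    have hint : Integrable (fun x => |Φ x| ^ q) μ := by
      refine memLp_one_iff_integrable.1 (MemLp.mono_exponent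
        (memLp_top_of_bound (C := C ^ q) ?_ ?_) le_top)
      · exact (Real.continuous_rpow_const hq0.le).comp_aestronglyMeasurable hΦm.norm
      · filter_upwards [hC] with x hx
        rw [Real.norm_of_nonneg (by positivity)]
        exact Real.rpow_le_rpow (abs_nonneg _) hx hq0.le
    have e2 : N = ‖((∫ x, |Φ x| ^ q ∂μ : ℝ) : ℂ)‖ₑ := by
      rw [← ofReal_norm, Complex.norm_real, Real.norm_of_nonneg
        (integral_nonneg fun x => by positivity),
        ofReal_integral_eq_lintegral_ofReal hint (Eventually.of_forall fun x => by positivity), hN]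
      exact lintegral_congr henorm
    rw [e2, e1]
    refine (enorm_sum_le _ _).trans (le_of_eq (Finset.sum_congr rfl fun n _ => ?_))
    rw [enorm_mul, ← ofReal_norm (φ n : ℂ), Complex.norm_real, ofReal_norm]
  set B : ℝ≥0∞ := paleyConstant K p * levelSup a ω ^ expDiff p *
    (∑ n ∈ s, ENNReal.ofReal (((a n * ω n) ^ expDiff q * ‖(φ n : ℂ)‖) ^ q)) ^ (1 / q) with hB
  have hholder : ∑ n ∈ s, ‖φ n‖ₑ * ‖coeffOf μ u g n‖ₑ ≤ B * N ^ (1 / p) := by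
    have h1 := ENNReal.inner_le_Lp_mul_Lq s
      (fun n => ENNReal.ofReal ((a n * ω n) ^ expDiff q * ‖(φ n : ℂ)‖))
      (fun n => ENNReal.ofReal ((a n * ω n) ^ expDiff p * ‖coeffOf μ u g n‖)) hpq
    have h2 : ∀ n, ‖φ n‖ₑ * ‖coeffOf μ u g n‖ₑ =
        ENNReal.ofReal ((a n * ω n) ^ expDiff q * ‖(φ n : ℂ)‖) *
        ENNReal.ofReal ((a n * ω n) ^ expDiff p * ‖coeffOf μ u g n‖) := by
      intro n
      have hdn := Real.rpow_pos_of_pos (hd n) (expDiff p)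
      rw [← ENNReal.ofReal_mul (mul_nonneg (Real.rpow_nonneg (hd n).le _) (norm_nonneg _)),
        ← ofReal_norm, ← ofReal_norm,
        ← ENNReal.ofReal_mul (norm_nonneg _), hneg, Real.rpow_neg (hd n).le, Complex.norm_real]
      congr 1
      field_simp
    simp only [h2]
    refine h1.trans ?_
    have hn1 : ∀ n, 0 ≤ (a n * ω n) ^ expDiff q * ‖(φ n : ℂ)‖ := fun n =>
      mul_nonneg (Real.rpow_nonneg (hd n).le _) (norm_nonneg _)
    have hn2 : ∀ n, 0 ≤ (a n * ω n) ^ expDiff p * ‖coeffOf μ u g n‖ := fun n =>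
      mul_nonneg (Real.rpow_nonneg (hd n).le _) (norm_nonneg _)
    simp only [fun n => ENNReal.ofReal_rpow_of_nonneg (hn1 n) hq0.le,
      fun n => ENNReal.ofReal_rpow_of_nonneg (hn2 n) hp0.le]
    calc _ ≤ (∑ n ∈ s, ENNReal.ofReal (((a n * ω n) ^ expDiff q * ‖(φ n : ℂ)‖) ^ q)) ^ (1 / q) *
          (∑' n, ENNReal.ofReal (((a n * ω n) ^ expDiff p * ‖coeffOf μ u g n‖) ^ p)) ^ (1 / p) := by
            gcongr
            exact ENNReal.sum_le_tsum s
      _ ≤ _ := mul_le_mul_right (hu.paley ha hω hM hp1 hp2 hgp) _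
      _ = _ := by rw [hgpnorm, hB]; ring
  have hNB : N ≤ B * N ^ (1 / p) := hpair.trans hholder
  rw [hΦnorm]
  rcases eq_or_ne N 0 with h0 | h0
  · rw [h0, ENNReal.zero_rpow_of_pos (by positivity)]
    exact zero_le
  · have hNp0 : N ^ (1 / p) ≠ 0 := by simp [ENNReal.rpow_eq_zero_iff, h0, hNtop]
    have hNpt : N ^ (1 / p) ≠ ⊤ := ENNReal.rpow_ne_top_of_nonneg (by positivity) hNtop
    have hsplit : N = N ^ (1 / q) * N ^ (1 / p) := by
      rw [← ENNReal.rpow_add _ _ h0 hNtop, one_div, one_div, hpq.inv_add_inv_eq_one,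
        ENNReal.rpow_one]
    rw [hsplit] at hNB
    nth_rewrite 2 [← hsplit] at hNB
    exact (ENNReal.mul_le_mul_iff_left hNp0 hNpt).1 hNB

lemma memLp_sum (hu : IsBoundedOrthonormal μ u a K) (φ : ℕ → ℝ) (s : Finset ℕ) (p : ℝ≥0∞) :
    MemLp (fun x => ((∑ n ∈ s, φ n * u n x : ℝ) : ℂ)) p μ := by
  have : (fun x => ((∑ n ∈ s, φ n * u n x : ℝ) : ℂ)) =
      fun x => ∑ n ∈ s, (φ n : ℂ) * (u n x : ℂ) := by
    ext x; push_cast; rfl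
  rw [this]
  exact memLp_finsetSum _ fun n _ => (hu.memLp n p).const_mul _

lemma coeffOf_sum (hu : IsBoundedOrthonormal μ u a K) (φ : ℕ → ℝ) {s : Finset ℕ} {n : ℕ}
    (hn : n ∈ s) :
    coeffOf μ u (fun x => ((∑ k ∈ s, φ k * u k x : ℝ) : ℂ)) n = (φ n : ℂ) := by
  have h1 : ∀ k, Integrable (fun x => u k x * u n x) μ := fun k => by
    have := (hu.integrable_mul n (memLp_one_iff_integrable.1 (hu.memLp k 1))).re
    simpa [← Complex.ofReal_mul] using this
  unfold coeffOf
  have h2 : (fun x => ((∑ k ∈ s, φ k * u k x : ℝ) : ℂ) * (u n x : ℂ)) =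
      fun x => ((∑ k ∈ s, φ k * (u k x * u n x) : ℝ) : ℂ) := by
    ext x
    rw [← Complex.ofReal_mul, Finset.sum_mul]
    simp only [mul_assoc]
  rw [h2, integral_complex_ofReal, integral_finsetSum _ fun k _ => (h1 k).const_mul _]
  congr 1
  simp only [integral_const_mul, hu.orthonormal]
  simp [hn]

/-- The dual of Paley's inequality: a sequence for which the weighted sum is finite is the
sequence of coefficients of an `L_q` function, the limit of the partial sums. -/
theorem paley_dual (hu : IsBoundedOrthonormal μ u a K)
    (ha : ∀ n, 0 < a n) (hω : ∀ n, 0 < ω n) (hM : levelSup a ω < ⊤) {q : ℝ} (hq : 2 ≤ q)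
    (φ : ℕ → ℝ)
    (hφ : ∑' n, ENNReal.ofReal (((a n * ω n) ^ expDiff q * ‖(φ n : ℂ)‖) ^ q) < ⊤) :
    ∃ f : X → ℂ, MemLp f (ENNReal.ofReal q) μ ∧
      Tendsto (fun N : ℕ => eLpNorm (fun x =>
        ((∑ n ∈ Finset.range (N + 1), φ n * u n x : ℝ) : ℂ) - f x) (ENNReal.ofReal q) μ)
        atTop (𝓝 0) ∧
      (∀ n, coeffOf μ u f n = (φ n : ℂ)) ∧
      eLpNorm f (ENNReal.ofReal q) μ ≤
        paleyConstant K (Real.conjExponent q) * levelSup a ω ^ expDiff (Real.conjExponent q) *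
        (∑' n, ENNReal.ofReal (((a n * ω n) ^ expDiff q * ‖(φ n : ℂ)‖) ^ q)) ^ (1 / q) := by
  have hq0 : 0 < q := by linarith
  have hq1 : 1 ≤ ENNReal.ofReal q := by simpa using (by linarith : (1 : ℝ) ≤ q)
  have : Fact (1 ≤ ENNReal.ofReal q) := ⟨hq1⟩
  set t : ℕ → ℝ≥0∞ := fun n =>
    ENNReal.ofReal (((a n * ω n) ^ expDiff q * ‖(φ n : ℂ)‖) ^ q) with ht
  set B : ℝ≥0∞ := paleyConstant K (Real.conjExponent q) *
    levelSup a ω ^ expDiff (Real.conjExponent q) with hB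
  have hp : 1 < q.conjExponent := (Real.HolderConjugate.conjExponent (by linarith)).symm.lt
  have he : 0 ≤ expDiff (Real.conjExponent q) := by
    rw [expDiff_eq (by linarith), sub_nonneg, le_div_iff₀ (by linarith), one_mul,
      Real.conjExponent, div_le_iff₀ (by linarith)]
    linarith
  have hBtop : B ≠ ⊤ := ENNReal.mul_ne_top ENNReal.coe_ne_top
    (ENNReal.rpow_ne_top_of_nonneg he hM.ne)
  let S : ℕ → X → ℂ := fun N x => ((∑ n ∈ Finset.range (N + 1), φ n * u n x : ℝ) : ℂ)
  have hS : ∀ N, MemLp (S N) (ENNReal.ofReal q) μ := fun N => hu.memLp_sum φ _ _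
  have hdiff : ∀ N M, N ≤ M → eLpNorm (S M - S N) (ENNReal.ofReal q) μ ≤
      B * (∑' k, t (k + (N + 1))) ^ (1 / q) := by
    intro N M hNM
    have e : S M - S N = fun x => ((∑ n ∈ Finset.Ico (N + 1) (M + 1), φ n * u n x : ℝ) : ℂ) := by
      ext x
      rw [Finset.sum_Ico_eq_sub _ (by omega : N + 1 ≤ M + 1), Complex.ofReal_sub]
      rfl
    rw [e]
    refine (hu.eLpNorm_sum_le ha hω hM hq φ _).trans ?_
    gcongr
    rw [Finset.sum_Ico_eq_sum_range]
    simp only [add_comm (N + 1)]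
    exact ENNReal.sum_le_tsum _
  have htail : Tendsto (fun N : ℕ => B * (∑' k, t (k + (N + 1))) ^ (1 / q)) atTop (𝓝 0) := by
    have h1 := (ENNReal.tendsto_sum_nat_add t hφ.ne).comp (tendsto_add_atTop_nat 1)
    have h2 := (ENNReal.continuous_rpow_const (y := 1 / q)).tendsto 0
    rw [ENNReal.zero_rpow_of_pos (by positivity)] at h2
    have h3 := ENNReal.Tendsto.const_mul (h2.comp h1) (Or.inr hBtop)
    simpa using h3
  have hcauchy : CauchySeq fun N => (hS N).toLp := by
    rw [EMetric.cauchySeq_iff']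
    intro ε hε
    obtain ⟨N, hN⟩ := ((tendsto_order.1 htail).2 ε hε).exists
    refine ⟨N, fun M hM => ?_⟩
    rw [Lp.edist_toLp_toLp]
    exact (hdiff N M hM).trans_lt hN
  obtain ⟨F, hF⟩ := cauchySeq_tendsto_of_complete hcauchy
  have hlim : Tendsto (fun N : ℕ => eLpNorm (fun x => S N x - F x) (ENNReal.ofReal q) μ)
      atTop (𝓝 0) := by
    have h1 := tendsto_iff_edist_tendsto_0.1 hF
    refine h1.congr fun N => ?_
    rw [Lp.edist_def]
    refine eLpNorm_congr_ae ?_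
    filter_upwards [(hS N).coeFn_toLp] with x hx
    simp [hx]
  have hFm := Lp.memLp F
  have hint : ∀ {g : X → ℂ}, MemLp g (ENNReal.ofReal q) μ → Integrable g μ := fun hg =>
    hg.integrable hq1
  refine ⟨F, hFm, hlim, fun n => ?_, ?_⟩
  · -- The coefficients are continuous on `L_q`, since `L_q` embeds in `L_1`.
    have hbound : ∀ N, n ≤ N → ‖coeffOf μ u F n - φ n‖ₑ ≤ K * ENNReal.ofReal (a n) *
        (eLpNorm (fun x => S N x - F x) (ENNReal.ofReal q) μ *
          μ Set.univ ^ (1 / (1 : ℝ≥0∞).toReal - 1 / (ENNReal.ofReal q).toReal)) := by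
      intro N hN
      have hdecomp : coeffOf μ u (fun x => S N x - F x) n = φ n - coeffOf μ u F n := by
        have h1 := hu.coeffOf_add n ((hint (hS N)).sub (hint hFm)) (hint hFm)
        simp only [Pi.sub_apply, sub_add_cancel] at h1
        rw [hu.coeffOf_sum φ (by simpa using Nat.lt_succ_of_le hN)] at h1
        exact eq_sub_of_add_eq h1.symm
      rw [← enorm_neg, neg_sub, ← hdecomp]
      refine (hu.enorm_coeffOf_le n _).trans ?_
      gcongr
      rw [← eLpNorm_one_eq_lintegral_enorm]
      exact eLpNorm_le_eLpNorm_mul_rpow_measure_univ hq1 ((hS N).1.sub hFm.1)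
    have hzero : Tendsto (fun N : ℕ => K * ENNReal.ofReal (a n) *
        (eLpNorm (fun x => S N x - F x) (ENNReal.ofReal q) μ *
          μ Set.univ ^ (1 / (1 : ℝ≥0∞).toReal - 1 / (ENNReal.ofReal q).toReal))) atTop (𝓝 0) := by
      have hexp : 0 ≤ 1 / (1 : ℝ≥0∞).toReal - 1 / (ENNReal.ofReal q).toReal := by
        rw [ENNReal.toReal_ofReal hq0.le, ENNReal.toReal_one, sub_nonneg,
          div_le_div_iff₀ hq0 one_pos]
        linarith
      have h1 := ENNReal.Tendsto.mul_const (b := μ Set.univ ^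
        (1 / (1 : ℝ≥0∞).toReal - 1 / (ENNReal.ofReal q).toReal)) hlim
        (Or.inr (ENNReal.rpow_ne_top_of_nonneg hexp (measure_ne_top _ _)))
      have h2 := ENNReal.Tendsto.const_mul (a := K * ENNReal.ofReal (a n)) h1
        (Or.inr (by finiteness))
      simpa using h2
    have h0 : ‖coeffOf μ u F n - φ n‖ₑ ≤ 0 :=
      ge_of_tendsto hzero ((eventually_ge_atTop n).mono hbound)
    exact sub_eq_zero.1 (enorm_eq_zero.1 (le_zero_iff.1 h0))
  · have h1 : ∀ N, eLpNorm F (ENNReal.ofReal q) μ ≤ B * (∑' n, t n) ^ (1 / q) +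
        eLpNorm (fun x => S N x - F x) (ENNReal.ofReal q) μ := by
      intro N
      have h2 : (F : X → ℂ) = S N - (fun x => S N x - F x) := by ext x; simp
      nth_rewrite 1 [h2]
      refine (eLpNorm_sub_le (hS N).1 ((hS N).1.sub hFm.1) hq1).trans ?_
      refine add_le_add ?_ le_rfl
      refine (hu.eLpNorm_sum_le ha hω hM hq φ _).trans ?_
      gcongr
      exact ENNReal.sum_le_tsum _
    have h2 : Tendsto (fun N : ℕ => B * (∑' n, t n) ^ (1 / q) +
        eLpNorm (fun x => S N x - F x) (ENNReal.ofReal q) μ) atTop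
        (𝓝 (B * (∑' n, t n) ^ (1 / q) + 0)) := tendsto_const_nhds.add hlim
    rw [add_zero] at h2
    exact ge_of_tendsto' h2 h1

end IsBoundedOrthonormal

end

/-! ### The Jacobi weight -/

lemma weight_nonneg {α β t : ℝ} (ht : t ∈ Set.Icc (-1 : ℝ) 1) : 0 ≤ weight α β t :=
  mul_nonneg (Real.rpow_nonneg (by linarith [ht.2]) _) (Real.rpow_nonneg (by linarith [ht.1]) _)

lemma weight_pos {α β t : ℝ} (ht : t ∈ Set.Ioo (-1 : ℝ) 1) : 0 < weight α β t :=
  mul_pos (Real.rpow_pos_of_pos (by linarith [ht.2]) _) (Real.rpow_pos_of_pos (by linarith [ht.1]) _)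

lemma weight_add_one {α β t : ℝ} (ht : t ∈ Set.Ioo (-1 : ℝ) 1) :
    weight (α + 1) (β + 1) t = (1 - t ^ 2) * weight α β t := by
  have h1 : 0 < 1 - t := by linarith [ht.2]
  have h2 : 0 < 1 + t := by linarith [ht.1]
  rw [weight, weight, Real.rpow_add_one h1.ne', Real.rpow_add_one h2.ne']
  ring

lemma measurable_weight (α β : ℝ) : Measurable (weight α β) := by
  unfold weight
  fun_prop

lemma intervalIntegrable_weight {α β : ℝ} (hα : -1 < α) (hβ : -1 < β) :
    IntervalIntegrable (weight α β) volume (-1) 1 := by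
  have h1 : IntervalIntegrable (weight α β) volume (-1) 0 := by
    have h := (intervalIntegral.intervalIntegrable_rpow' (a := 0) (b := 1) hβ).comp_add_left 1
    norm_num at h
    refine (h.continuousOn_mul (g := fun t : ℝ => (1 - t) ^ α) ?_)
    refine ContinuousOn.rpow_const (by fun_prop) fun t ht => Or.inl ?_
    rw [Set.uIcc_of_le (by norm_num)] at ht
    linarith [ht.2]
  have h2 : IntervalIntegrable (weight α β) volume 0 1 := by
    have h := (intervalIntegral.intervalIntegrable_rpow' (a := 0) (b := 1) hα).comp_sub_left 1
    norm_num at h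
    refine (h.symm.mul_continuousOn (g := fun t : ℝ => (1 + t) ^ β) ?_)
    refine ContinuousOn.rpow_const (by fun_prop) fun t ht => Or.inl ?_
    rw [Set.uIcc_of_le (by norm_num)] at ht
    linarith [ht.1]
  exact h1.trans h2

lemma intervalIntegrable_mul_weight {α β : ℝ} (hα : -1 < α) (hβ : -1 < β) {g : ℝ → ℝ}
    (hg : Continuous g) : IntervalIntegrable (fun t => g t * weight α β t) volume (-1) 1 :=
  (intervalIntegrable_weight hα hβ).continuousOn_mul hg.continuousOn

lemma integral_weightMeasure (α β : ℝ) (g : ℝ → ℝ) :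
    ∫ t, g t ∂weightMeasure α β = ∫ t in (-1)..1, g t * weight α β t := by
  rw [weightMeasure, integral_withDensity_eq_integral_toReal_smul
    (measurable_weight α β).ennreal_ofReal (Eventually.of_forall fun _ => ENNReal.ofReal_lt_top),
    integral_Icc_eq_integral_Ioc, ← intervalIntegral.integral_of_le (by norm_num)]
  refine intervalIntegral.integral_congr fun t ht => ?_
  rw [Set.uIcc_of_le (by norm_num)] at ht
  simp only [smul_eq_mul]
  rw [ENNReal.toReal_ofReal (weight_nonneg ht), mul_comm]

lemma isFiniteMeasure_weightMeasure {α β : ℝ} (hα : -1 < α) (hβ : -1 < β) :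
    IsFiniteMeasure (weightMeasure α β) := by
  have h := (intervalIntegrable_iff_integrableOn_Icc_of_le (by norm_num)).1
    (intervalIntegrable_weight hα hβ)
  exact isFiniteMeasure_withDensity_ofReal h.2

lemma ae_weightMeasure_mem (α β : ℝ) : ∀ᵐ t ∂weightMeasure α β, t ∈ Set.Icc (-1 : ℝ) 1 :=
  (withDensity_absolutelyContinuous _ _).ae_le (ae_restrict_mem measurableSet_Icc)

/-- The integrand is the derivative of `weight (α + 1) (β + 1) t * u(t)`, which vanishes at both
endpoints. -/
lemma integral_divergence {α β : ℝ} (hα : -1 < α) (hβ : -1 < β) (u : ℝ[X]) :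
    ∫ t in (-1)..1, ((1 - t ^ 2) * (derivative u).eval t +
      (β - α - (α + β + 2) * t) * u.eval t) * weight α β t = 0 := by
  have h := intervalIntegral.integral_eq_sub_of_hasDerivAt_of_le (a := -1) (b := 1)
    (f := fun t => weight (α + 1) (β + 1) t * u.eval t)
    (f' := fun t => ((1 - t ^ 2) * (derivative u).eval t +
      (β - α - (α + β + 2) * t) * u.eval t) * weight α β t) (by norm_num) ?_ ?_ ?_
  · rw [h]
    simp [weight, Real.zero_rpow (show α + 1 ≠ 0 by linarith),
      Real.zero_rpow (show β + 1 ≠ 0 by linarith)]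
  · unfold weight
    refine ContinuousOn.mul (ContinuousOn.mul ?_ ?_) u.continuousOn
    · exact ContinuousOn.rpow_const (by fun_prop) fun _ _ => Or.inr (by linarith)
    · exact ContinuousOn.rpow_const (by fun_prop) fun _ _ => Or.inr (by linarith)
  · intro t ht
    have h1 : 0 < 1 - t := by linarith [ht.2]
    have h2 : 0 < 1 + t := by linarith [ht.1]
    have d1 : HasDerivAt (fun t : ℝ => (1 - t) ^ (α + 1)) (-1 * (α + 1) * (1 - t) ^ (α + 1 - 1)) t :=
      ((hasDerivAt_id t).const_sub 1).rpow_const (Or.inl h1.ne')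
    have d2 : HasDerivAt (fun t : ℝ => (1 + t) ^ (β + 1)) (1 * (β + 1) * (1 + t) ^ (β + 1 - 1)) t :=
      ((hasDerivAt_id t).const_add 1).rpow_const (Or.inl h2.ne')
    have := (d1.mul d2).mul (u.hasDerivAt t)
    refine this.congr_deriv ?_
    simp only [weight, Pi.mul_apply, add_sub_cancel_right]
    rw [Real.rpow_add_one h1.ne', Real.rpow_add_one h2.ne']
    ring
  · exact intervalIntegrable_mul_weight hα hβ (by fun_prop)

lemma integral_weight_pos {α β : ℝ} (hα : -1 < α) (hβ : -1 < β) :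
    0 < ∫ t in (-1)..1, weight α β t :=
  intervalIntegral.intervalIntegral_pos_of_pos_on (intervalIntegrable_weight hα hβ)
    (fun _ ht => weight_pos ht) (by norm_num)

lemma integral_mul_weight_add_one (α β : ℝ) (g : ℝ → ℝ) :
    ∫ t in (-1)..1, g t * weight (α + 1) (β + 1) t =
      ∫ t in (-1)..1, g t * (1 - t ^ 2) * weight α β t := by
  rw [intervalIntegral.integral_of_le (by norm_num), intervalIntegral.integral_of_le (by norm_num),
    integral_Ioc_eq_integral_Ioo, integral_Ioc_eq_integral_Ioo]
  refine setIntegral_congr_fun measurableSet_Ioo fun t ht => ?_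
  simp only [weight_add_one ht, mul_assoc]

lemma integral_weight_add_one {α β : ℝ} (hα : -1 < α) (hβ : -1 < β) :
    (α + β + 2) * (α + β + 3) * ∫ t in (-1)..1, weight (α + 1) (β + 1) t =
      4 * (α + 1) * (β + 1) * ∫ t in (-1)..1, weight α β t := by
  have i0 := intervalIntegrable_weight hα hβ
  have i1 := intervalIntegrable_mul_weight hα hβ continuous_id
  have i2 := intervalIntegrable_mul_weight hα hβ (continuous_pow 2)
  have d1 := integral_divergence hα hβ 1
  have d2 := integral_divergence hα hβ X
  have e := integral_mul_weight_add_one α β (fun _ => 1)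
  simp only [one_mul, id] at e i1
  have e0 : ∫ t in (-1)..1, (1 - t ^ 2) * weight α β t =
      (∫ t in (-1)..1, weight α β t) - ∫ t in (-1)..1, t ^ 2 * weight α β t := by
    rw [← intervalIntegral.integral_sub i0 i2]
    congr 1 with t; ring
  have e1 : ∫ t in (-1)..1, ((1 - t ^ 2) * (derivative (1 : ℝ[X])).eval t +
      (β - α - (α + β + 2) * t) * (1 : ℝ[X]).eval t) * weight α β t =
      (β - α) * (∫ t in (-1)..1, weight α β t) -
        (α + β + 2) * ∫ t in (-1)..1, t * weight α β t := by
    rw [← intervalIntegral.integral_const_mul, ← intervalIntegral.integral_const_mul,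
      ← intervalIntegral.integral_sub (i0.const_mul _) (i1.const_mul _)]
    congr 1 with t; simp; ring
  have e2 : ∫ t in (-1)..1, ((1 - t ^ 2) * (derivative (X : ℝ[X])).eval t +
      (β - α - (α + β + 2) * t) * (X : ℝ[X]).eval t) * weight α β t =
      (∫ t in (-1)..1, weight α β t) + (β - α) * (∫ t in (-1)..1, t * weight α β t) -
        (α + β + 3) * ∫ t in (-1)..1, t ^ 2 * weight α β t := by
    rw [← intervalIntegral.integral_const_mul, ← intervalIntegral.integral_const_mul,
      ← intervalIntegral.integral_add i0 (i1.const_mul _),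
      ← intervalIntegral.integral_sub (i0.add (i1.const_mul _)) (i2.const_mul _)]
    congr 1 with t; simp; ring
  rw [e1] at d1
  rw [e2] at d2
  rw [e, e0]
  linear_combination (β - α) * d1 + (α + β + 2) * d2

/-! ### The differential equation and orthogonality -/

/-- The Jacobi differential operator `(1 - t²) y'' + (β - α - (α + β + 2) t) y'`. -/
def jacobiOp (α β : ℝ) (y : ℝ[X]) : ℝ[X] :=
  (1 - X ^ 2) * derivative (derivative y) + (C (β - α) - C (α + β + 2) * X) * derivative y

/-- Integration by parts: the Jacobi operator is symmetric, with the quadratic form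
`∫ y' z' (1 - t) ^ (α + 1) (1 + t) ^ (β + 1)`. -/
lemma integral_jacobiOp_mul {α β : ℝ} (hα : -1 < α) (hβ : -1 < β) (y z : ℝ[X]) :
    ∫ t in (-1)..1, (jacobiOp α β y * z).eval t * weight α β t =
      -∫ t in (-1)..1, (derivative y * derivative z).eval t * weight (α + 1) (β + 1) t := by
  rw [integral_mul_weight_add_one, eq_neg_iff_add_eq_zero,
    ← intervalIntegral.integral_add (intervalIntegrable_mul_weight hα hβ (by fun_prop))
      (intervalIntegrable_mul_weight hα hβ (by fun_prop)),
    ← integral_divergence hα hβ (derivative y * z)]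
  congr 1 with t
  simp [jacobiOp]
  ring

/-- The coefficient of `((t - 1) / 2) ^ k` in the Jacobi polynomial. -/
def jacobiCoeff (α β : ℝ) (n k : ℕ) : ℝ :=
  (ascPochhammer ℝ k).eval ((n : ℝ) + α + β + 1) *
    (ascPochhammer ℝ (n - k)).eval (α + (k : ℝ) + 1) / ((k.factorial : ℝ) * ((n - k).factorial : ℝ))

lemma jacobiCoeff_succ (α β : ℝ) {n k : ℕ} (hk : k < n) :
    ((k : ℝ) + 1) * (k + 1 + α) * jacobiCoeff α β n (k + 1) =
      (n - k) * (n + k + α + β + 1) * jacobiCoeff α β n k := by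
  obtain ⟨m, rfl⟩ : ∃ m, n = k + m + 1 := ⟨n - k - 1, by omega⟩
  have h1 : k + m + 1 - k = m + 1 := by omega
  have h2 : k + m + 1 - (k + 1) = m := by omega
  rw [jacobiCoeff, jacobiCoeff, h1, h2, ascPochhammer_succ_right, ascPochhammer_succ_left ℝ m,
    Nat.factorial_succ, Nat.factorial_succ]
  simp only [eval_mul, eval_add, eval_X, eval_natCast, eval_comp, eval_one]
  have : (k.factorial : ℝ) ≠ 0 := by positivity
  have : (m.factorial : ℝ) ≠ 0 := by positivity
  push_cast
  rw [show α + (k : ℝ) + 1 + 1 = α + ((k : ℝ) + 1) + 1 by ring]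
  field_simp
  ring

lemma jacobi_eq_sum (α β : ℝ) (n : ℕ) : jacobi α β n =
    ∑ k ∈ Finset.range (n + 1), C (jacobiCoeff α β n k) * (C (1 / 2) * (X - 1)) ^ k := rfl

lemma derivative_half_pow (k : ℕ) : derivative ((C (1 / 2 : ℝ) * (X - 1)) ^ k) =
    C (k / 2 : ℝ) * (C (1 / 2) * (X - 1)) ^ (k - 1) := by
  rw [derivative_pow]
  simp only [derivative_mul, derivative_C, derivative_sub, derivative_X, derivative_one]
  rw [div_eq_mul_one_div (k : ℝ), C_mul]
  ring

lemma jacobiOp_pow (α β : ℝ) (k : ℕ) : jacobiOp α β ((C (1 / 2) * (X - 1)) ^ k) =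
    -(C (k * (k + α)) * (C (1 / 2) * (X - 1)) ^ (k - 1) +
      C (k * (k + α + β + 1)) * (C (1 / 2) * (X - 1)) ^ k) := by
  unfold jacobiOp
  rw [derivative_half_pow, derivative_C_mul, derivative_half_pow]
  refine Polynomial.funext fun t => ?_
  simp only [eval_add, eval_mul, eval_sub, eval_one, eval_pow, eval_X, eval_C, eval_neg]
  obtain ⟨v, rfl⟩ : ∃ v, t = 1 + 2 * v := ⟨(t - 1) / 2, by ring⟩
  rw [show 1 / 2 * (1 + 2 * v - 1) = v by ring]
  rcases k with _ | _ | k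
  · simp
  · norm_num
    ring
  · simp only [Nat.add_sub_cancel]
    push_cast
    ring

lemma jacobiOp_add (α β : ℝ) (y z : ℝ[X]) :
    jacobiOp α β (y + z) = jacobiOp α β y + jacobiOp α β z := by
  simp only [jacobiOp, derivative_add]
  ring

lemma jacobiOp_C_mul (α β c : ℝ) (y : ℝ[X]) :
    jacobiOp α β (C c * y) = C c * jacobiOp α β y := by
  simp only [jacobiOp, derivative_C_mul]
  ring

/-- The Jacobi polynomial is an eigenfunction of the Jacobi operator. On powers of
`(t - 1) / 2` that operator is bidiagonal, so the sum over the first `m + 1` powers leaves only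
one term, which vanishes for `m = n`. -/
lemma jacobiOp_jacobi (α β : ℝ) (n : ℕ) :
    jacobiOp α β (jacobi α β n) = -(C (n * (n + α + β + 1)) * jacobi α β n) := by
  have key : ∀ m ≤ n, jacobiOp α β
        (∑ k ∈ Finset.range (m + 1), C (jacobiCoeff α β n k) * (C (1 / 2) * (X - 1)) ^ k) =
      -(C (n * (n + α + β + 1)) *
        ∑ k ∈ Finset.range (m + 1), C (jacobiCoeff α β n k) * (C (1 / 2) * (X - 1)) ^ k) +
      C ((n - m) * (n + m + α + β + 1) * jacobiCoeff α β n m) * (C (1 / 2) * (X - 1)) ^ m := by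
    intro m
    induction m with
    | zero =>
      intro _
      simp [jacobiOp]
    | succ m ih =>
      intro hm
      rw [Finset.sum_range_succ, jacobiOp_add, ih (by omega), jacobiOp_C_mul, jacobiOp_pow,
        ← jacobiCoeff_succ α β (by omega : m < n)]
      simp only [Nat.add_sub_cancel, C_mul, C_add, C_sub, Nat.cast_add, Nat.cast_one, C_1]
      ring
  rw [jacobi_eq_sum, key n le_rfl]
  simp

lemma derivative_jacobi_succ (α β : ℝ) (n : ℕ) :
    derivative (jacobi α β (n + 1)) =
      C ((n + α + β + 2) / 2) * jacobi (α + 1) (β + 1) n := by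
  rw [jacobi_eq_sum, jacobi_eq_sum, Finset.sum_range_succ', derivative_add, derivative_sum,
    Finset.mul_sum]
  simp only [derivative_C_mul, derivative_half_pow, pow_zero, derivative_one, mul_zero, add_zero,
    Nat.add_sub_cancel]
  simp only [← mul_assoc, ← C_mul]
  refine Finset.sum_congr rfl fun k hk => ?_
  congr 2
  have h : n + 1 - (k + 1) = n - k := by omega
  rw [jacobiCoeff, jacobiCoeff, h, ascPochhammer_succ_left, Nat.factorial_succ]
  simp only [eval_mul, eval_add, eval_X, eval_comp, eval_one]
  push_cast
  have : (k.factorial : ℝ) ≠ 0 := by positivity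
  have : ((n - k).factorial : ℝ) ≠ 0 := by positivity
  rw [show (n : ℝ) + 1 + α + β + 1 + 1 = n + (α + 1) + (β + 1) + 1 by ring,
    show α + ((k : ℝ) + 1) + 1 = α + 1 + k + 1 by ring]
  field_simp
  ring

lemma jacobi_zero (α β : ℝ) : jacobi α β 0 = 1 := by
  simp [jacobi]

lemma eval_one_jacobi (α β : ℝ) (n : ℕ) :
    (jacobi α β n).eval 1 = (ascPochhammer ℝ n).eval (α + 1) / n.factorial := by
  rw [jacobi_eq_sum, Finset.sum_range_succ']
  simp [eval_finsetSum, jacobiCoeff]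

/-- At `-1` the differential equation is a relation between a Jacobi polynomial and its
derivative, which is again a Jacobi polynomial. -/
lemma eval_neg_one_jacobi {α β : ℝ} (hα : -1 < α) (hβ : -1 < β) (n : ℕ) :
    (jacobi α β n).eval (-1) = (-1) ^ n * (ascPochhammer ℝ n).eval (β + 1) / n.factorial := by
  induction n generalizing α β with
  | zero => simp [jacobi_zero]
  | succ n ih =>
    have h := congrArg (eval (-1)) (jacobiOp_jacobi α β (n + 1))
    rw [jacobiOp] at h
    simp only [eval_add, eval_mul, eval_sub, eval_one, eval_pow, eval_X, eval_C, eval_neg,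
      derivative_jacobi_succ, ih (by linarith : -1 < α + 1) (by linarith : -1 < β + 1)] at h
    have hs : (0 : ℝ) < n + α + β + 2 := by
      have : (0 : ℝ) ≤ n := n.cast_nonneg
      linarith
    rw [ascPochhammer_succ_left, Nat.factorial_succ]
    simp only [eval_mul, eval_add, eval_X, eval_comp, eval_one]
    have : (n.factorial : ℝ) ≠ 0 := by positivity
    push_cast at h ⊢
    have h' : (n + α + β + 2) * (((n : ℝ) + 1) * (jacobi α β (n + 1)).eval (-1)) =
        (n + α + β + 2) * (-(β + 1) * ((-1) ^ n * (ascPochhammer ℝ n).eval (β + 1 + 1) /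
          n.factorial)) := by
      linear_combination h
    have h'' := mul_left_cancel₀ hs.ne' h'
    rw [eq_div_iff (by positivity), pow_succ]
    field_simp at h''
    linear_combination h''

/-- Jacobi polynomials of different degrees are orthogonal. -/
lemma integral_jacobi_mul_jacobi {α β : ℝ} (hα : -1 < α) (hβ : -1 < β) {n m : ℕ} (hnm : n ≠ m) :
    ∫ t in (-1)..1, (jacobi α β n * jacobi α β m).eval t * weight α β t = 0 := by
  have key : ∀ n m : ℕ, (n * (n + α + β + 1)) *
      ∫ t in (-1)..1, (jacobi α β n * jacobi α β m).eval t * weight α β t =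
      ∫ t in (-1)..1, (derivative (jacobi α β n) * derivative (jacobi α β m)).eval t *
        weight (α + 1) (β + 1) t := by
    intro n m
    have h := integral_jacobiOp_mul hα hβ (jacobi α β n) (jacobi α β m)
    rw [jacobiOp_jacobi, eq_neg_iff_add_eq_zero, add_comm, ← eq_neg_iff_add_eq_zero,
      ← intervalIntegral.integral_neg] at h
    rw [h, ← intervalIntegral.integral_const_mul]
    congr 1 with t
    simp
    ring
  have h1 := key n m
  have h2 := key m n
  rw [mul_comm (derivative _), ← h1, mul_comm (jacobi α β m)] at h2
  have h3 : ((m : ℝ) - n) * (n + m + α + β + 1) = 0 ∨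
      ∫ t in (-1)..1, (jacobi α β n * jacobi α β m).eval t * weight α β t = 0 := by
    rw [← mul_eq_zero]
    linear_combination h2
  refine h3.resolve_left (mul_ne_zero (sub_ne_zero.2 (by exact_mod_cast hnm.symm)) ?_)
  have : (1 : ℝ) ≤ n + m := by exact_mod_cast (by omega : 1 ≤ n + m)
  linarith

/-- The square of the norm of a Jacobi polynomial. -/
def normSq (α β : ℝ) (n : ℕ) : ℝ :=
  ∫ t in (-1)..1, (jacobi α β n).eval t ^ 2 * weight α β t

/-- The weighted `L₂` norm of the derivative, from the quadratic form of the Jacobi operator. -/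
lemma normSq_energy {α β : ℝ} (hα : -1 < α) (hβ : -1 < β) (n : ℕ) :
    ∫ t in (-1)..1, ((1 - t ^ 2) * (derivative (jacobi α β n)).eval t ^ 2) * weight α β t =
      n * (n + α + β + 1) * normSq α β n := by
  have h := integral_jacobiOp_mul hα hβ (jacobi α β n) (jacobi α β n)
  rw [jacobiOp_jacobi, eq_neg_iff_add_eq_zero, add_comm, ← eq_neg_iff_add_eq_zero,
    ← intervalIntegral.integral_neg, integral_mul_weight_add_one] at h
  rw [normSq, ← intervalIntegral.integral_const_mul]
  refine Eq.trans ?_ (h.trans ?_)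
  · congr 1 with t
    rw [eval_mul]
    ring
  · congr 1 with t
    simp only [eval_mul, eval_neg, eval_C]
    ring

/-- The derivative of a Jacobi polynomial is a Jacobi polynomial for the parameters `α + 1` and
`β + 1`, which relates the norms. -/
lemma normSq_succ {α β : ℝ} (hα : -1 < α) (hβ : -1 < β) (n : ℕ) :
    4 * (n + 1) * normSq α β (n + 1) = (n + α + β + 2) * normSq (α + 1) (β + 1) n := by
  have hs : (0 : ℝ) < n + α + β + 2 := by
    have : (0 : ℝ) ≤ n := n.cast_nonneg
    linarith
  have h := normSq_energy hα hβ (n + 1)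
  have e : ∫ t in (-1)..1, ((1 - t ^ 2) * (derivative (jacobi α β (n + 1))).eval t ^ 2) *
      weight α β t = ((n + α + β + 2) / 2) ^ 2 * normSq (α + 1) (β + 1) n := by
    rw [normSq, ← intervalIntegral.integral_const_mul]
    rw [← intervalIntegral.integral_congr fun t _ => (mul_assoc (((n + α + β + 2) / 2) ^ 2)
      (eval t (jacobi (α + 1) (β + 1) n) ^ 2) (weight (α + 1) (β + 1) t)),
      integral_mul_weight_add_one, derivative_jacobi_succ]
    congr 1 with t
    rw [eval_mul, eval_C]
    ring
  rw [e] at h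
  push_cast at h
  refine mul_left_cancel₀ hs.ne' ?_
  linear_combination -4 * h

/-- The value of the norm of a Jacobi polynomial, in terms of the total mass of the weight. -/
lemma normSq_eq {α β : ℝ} (hα : -1 < α) (hβ : -1 < β) (n : ℕ) :
    normSq α β n * (n.factorial * (2 * n + α + β + 1) *
        (ascPochhammer ℝ n).eval (α + β + 2)) =
      (ascPochhammer ℝ n).eval (α + 1) * (ascPochhammer ℝ n).eval (β + 1) *
        (∫ t in (-1)..1, weight α β t) * (n + α + β + 1) := by
  induction n generalizing α β with
  | zero => simp [normSq, jacobi_zero]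
  | succ n ih =>
    have h1 := ih (by linarith : -1 < α + 1) (by linarith : -1 < β + 1)
    have h2 := normSq_succ hα hβ n
    have h3 := integral_weight_add_one hα hβ
    have hs : (0 : ℝ) < n + α + β + 2 := by
      have : (0 : ℝ) ≤ n := n.cast_nonneg
      linarith
    have hs3 : (0 : ℝ) < α + β + 3 := by linarith
    -- Two ways of splitting off factors from `(α + β + 2) ⋯ (α + β + n + 3)`.
    have h4 : (α + β + 2) * (α + β + 3) * (ascPochhammer ℝ n).eval (α + 1 + (β + 1) + 2) =
        (ascPochhammer ℝ (n + 1)).eval (α + β + 2) * (α + β + n + 3) := by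
      have a := congrArg (eval (α + β + 2)) (ascPochhammer_succ_left ℝ (n + 1))
      have b := congrArg (eval (α + β + 2)) (ascPochhammer_succ_right ℝ (n + 1))
      have c := congrArg (eval (α + β + 3)) (ascPochhammer_succ_left ℝ n)
      simp only [eval_mul, eval_add, eval_X, eval_comp, eval_one, eval_natCast] at a b c
      rw [show α + β + 2 + 1 = α + β + 3 by ring, c, show α + β + 3 + 1 = α + 1 + (β + 1) + 2 by ring,
        b] at a
      push_cast at a
      linear_combination -a
    have e1 : (ascPochhammer ℝ (n + 1)).eval (α + 1) =
        (α + 1) * (ascPochhammer ℝ n).eval (α + 1 + 1) := by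
      simp [ascPochhammer_succ_left]
    have e2 : (ascPochhammer ℝ (n + 1)).eval (β + 1) =
        (β + 1) * (ascPochhammer ℝ n).eval (β + 1 + 1) := by
      simp [ascPochhammer_succ_left]
    rw [e1, e2, Nat.factorial_succ]
    have hs4 : (0 : ℝ) < α + β + n + 3 := by linarith
    refine mul_left_cancel₀ (mul_ne_zero four_ne_zero hs4.ne') ?_
    push_cast at h1 ⊢
    generalize (ascPochhammer ℝ (n + 1)).eval (α + β + 2) = Q at *
    generalize (ascPochhammer ℝ n).eval (α + 1 + (β + 1) + 2) = R at *
    generalize (ascPochhammer ℝ n).eval (α + 1 + 1) = A at *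
    generalize (ascPochhammer ℝ n).eval (β + 1 + 1) = B at *
    generalize (∫ t in (-1)..1, weight (α + 1) (β + 1) t) = J at *
    generalize (∫ t in (-1)..1, weight α β t) = I at *
    generalize normSq α β (n + 1) = N1 at *
    generalize normSq (α + 1) (β + 1) n = N0 at *
    calc _ = (4 * (n + 1) * N1) * (n.factorial * (2 * (n + 1) + α + β + 1)) *
          (Q * (α + β + n + 3)) := by ring
      _ = (n + α + β + 2) * ((α + β + 2) * (α + β + 3)) *
          (N0 * (n.factorial * (2 * n + (α + 1) + (β + 1) + 1) * R)) := by
            rw [h2, ← h4]; ring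
      _ = (n + α + β + 2) * (A * B * (n + α + β + 3)) *
          ((α + β + 2) * (α + β + 3) * J) := by rw [h1]; ring
      _ = _ := by rw [h3]; ring

/-! ### Growth of the normalized endpoint values -/

/-- Euler's limit formula for the Gamma function, in terms of the rising factorial. -/
lemma tendsto_ascPochhammer_div {x : ℝ} (hx : 0 < x) :
    Tendsto (fun n : ℕ => (ascPochhammer ℝ n).eval x / (n.factorial * (n : ℝ) ^ (x - 1)))
      atTop (𝓝 (Real.Gamma x)⁻¹) := by
  have h1 := (Real.GammaSeq_tendsto_Gamma x).inv₀ (Real.Gamma_pos_of_pos hx).ne'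
  have h2 : Tendsto (fun n : ℕ => (n : ℝ) / (n + x)) atTop (𝓝 1) :=
    tendsto_natCast_div_add_atTop x
  have hprod : ∀ m : ℕ, ∏ j ∈ Finset.range m, (x + j) = (ascPochhammer ℝ m).eval x := by
    intro m
    induction m with
    | zero => simp
    | succ m ih => rw [Finset.prod_range_succ, ih, ascPochhammer_succ_right]; simp
  have h3 := h2.mul h1
  rw [one_mul] at h3
  refine h3.congr' ?_
  filter_upwards [eventually_gt_atTop 0] with n hn
  have hn0 : (0 : ℝ) < n := by exact_mod_cast hn
  rw [Real.GammaSeq, Finset.prod_range_succ, hprod,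
    Real.rpow_sub_one hn0.ne']
  have := ascPochhammer_pos n x hx
  have := Real.rpow_pos_of_pos hn0 x
  field_simp
  rw [add_comm]

/-- Up to constants, `(x)_n` is `n! n ^ (x - 1)`. -/
lemma exists_ascPochhammer_bounds {x : ℝ} (hx : 0 < x) :
    ∃ C > 0, ∀ n : ℕ, 0 < n →
      (ascPochhammer ℝ n).eval x ≤ C * (n.factorial * (n : ℝ) ^ (x - 1)) ∧
      n.factorial * (n : ℝ) ^ (x - 1) ≤ C * (ascPochhammer ℝ n).eval x := by
  have h1 := tendsto_ascPochhammer_div hx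
  have h2 := h1.inv₀ (inv_ne_zero (Real.Gamma_pos_of_pos hx).ne')
  obtain ⟨C1, hC1⟩ := h1.bddAbove_range
  obtain ⟨C2, hC2⟩ := h2.bddAbove_range
  refine ⟨max 1 (max C1 C2), by positivity, fun n hn => ?_⟩
  have hn0 : (0 : ℝ) < n := by exact_mod_cast hn
  have hp := ascPochhammer_pos n x hx
  have hq : 0 < n.factorial * (n : ℝ) ^ (x - 1) := by positivity
  have a1 : (ascPochhammer ℝ n).eval x / (n.factorial * (n : ℝ) ^ (x - 1)) ≤ C1 :=
    hC1 (Set.mem_range_self n)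
  have a2 : ((ascPochhammer ℝ n).eval x / (n.factorial * (n : ℝ) ^ (x - 1)))⁻¹ ≤ C2 :=
    hC2 (Set.mem_range_self n)
  rw [inv_div] at a2
  exact ⟨(div_le_iff₀ hq).1 (a1.trans ((le_max_left _ _).trans (le_max_right _ _))),
    (div_le_iff₀ hp).1 (a2.trans ((le_max_right _ _).trans (le_max_right _ _)))⟩

/-- The ratio of `P_n(1) ^ 2` to the squared norm of `P_n`, with the total mass of the weight
cancelled, is `O(n ^ (2α + 1))`. -/
lemma exists_ascPochhammer_ratio_le {α β : ℝ} (hα : -1 < α) (hβ : -1 < β) :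
    ∃ C > 0, ∀ n : ℕ, 0 < n →
      ((ascPochhammer ℝ n).eval (α + 1) / n.factorial) ^ 2 *
        (n.factorial * (2 * n + α + β + 1) * (ascPochhammer ℝ n).eval (α + β + 2)) ≤
      C * (n : ℝ) ^ (2 * α + 1) *
        ((ascPochhammer ℝ n).eval (α + 1) * (ascPochhammer ℝ n).eval (β + 1) *
          (n + α + β + 1)) := by
  obtain ⟨C1, h1, H1⟩ := exists_ascPochhammer_bounds (x := α + 1) (by linarith)
  obtain ⟨C2, h2, H2⟩ := exists_ascPochhammer_bounds (x := β + 1) (by linarith)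
  obtain ⟨C3, h3, H3⟩ := exists_ascPochhammer_bounds (x := α + β + 2) (by linarith)
  have hs : 0 < α + β + 2 := by linarith
  refine ⟨C1 * C3 * C2 * (2 + 1 / (α + β + 2)), by positivity, fun n hn => ?_⟩
  have hn0 : (0 : ℝ) < n := by exact_mod_cast hn
  have hn1 : (1 : ℝ) ≤ n := by exact_mod_cast hn
  have hA := ascPochhammer_pos n (α + 1) (by linarith)
  have hB := ascPochhammer_pos n (β + 1) (by linarith)
  have hS := ascPochhammer_pos n (α + β + 2) (by linarith)
  have b1 := (H1 n hn).1
  have b2 := (H2 n hn).2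
  have b3 := (H3 n hn).1
  have b4 : 2 * n + α + β + 1 ≤ (2 + 1 / (α + β + 2)) * (n + α + β + 1) := by
    have h6 : 1 ≤ 1 / (α + β + 2) * (n + α + β + 1) := by
      rw [one_div_mul_eq_div, le_div_iff₀ hs]
      linarith
    linarith
  have e1 : (n : ℝ) ^ (2 * α + 1) * ((n : ℝ) ^ (β + 1 - 1)) =
      (n : ℝ) ^ (α + 1 - 1) * (n : ℝ) ^ (α + β + 2 - 1) := by
    rw [← Real.rpow_add hn0, ← Real.rpow_add hn0]
    congr 1; ring
  generalize (ascPochhammer ℝ n).eval (α + 1) = A at *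
  generalize (ascPochhammer ℝ n).eval (β + 1) = B at *
  generalize (ascPochhammer ℝ n).eval (α + β + 2) = S at *
  have hf : (0 : ℝ) < n.factorial := by positivity
  have hu : 0 < (n : ℝ) ^ (α + 1 - 1) := by positivity
  have hv : 0 < (n : ℝ) ^ (β + 1 - 1) := by positivity
  have hw : 0 < (n : ℝ) ^ (α + β + 2 - 1) := by positivity
  have hz : 0 < (n : ℝ) ^ (2 * α + 1) := by positivity
  generalize (n : ℝ) ^ (α + 1 - 1) = u at *
  generalize (n : ℝ) ^ (β + 1 - 1) = v at *
  generalize (n : ℝ) ^ (α + β + 2 - 1) = w at *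
  generalize (n : ℝ) ^ (2 * α + 1) = z at *
  have h5 : 0 ≤ 2 * n + α + β + 1 := by linarith
  calc (A / n.factorial) ^ 2 * (n.factorial * (2 * n + α + β + 1) * S)
      = A * (A * S * (2 * n + α + β + 1)) / n.factorial := by field_simp
    _ ≤ A * ((C1 * (n.factorial * u)) * (C3 * (n.factorial * w)) *
          ((2 + 1 / (α + β + 2)) * (n + α + β + 1))) / n.factorial := by gcongr
    _ = C1 * C3 * (2 + 1 / (α + β + 2)) * z * A * (n.factorial * v) * (n + α + β + 1) := by
        field_simp
        linear_combination (-(n + α + β + 1)) * e1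
    _ ≤ C1 * C3 * (2 + 1 / (α + β + 2)) * z * A * (C2 * B) * (n + α + β + 1) := by
        have : 0 ≤ (n : ℝ) + α + β + 1 := by linarith
        gcongr
    _ = _ := by ring

lemma normSq_pos {α β : ℝ} (hα : -1 < α) (hβ : -1 < β) (n : ℕ) : 0 < normSq α β n := by
  induction n generalizing α β with
  | zero =>
    simpa [normSq, jacobi_zero] using integral_weight_pos hα hβ
  | succ n ih =>
    have h := normSq_succ hα hβ n
    have h1 := ih (by linarith : -1 < α + 1) (by linarith : -1 < β + 1)
    have h2 : (0 : ℝ) ≤ n := n.cast_nonneg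
    have h3 : 0 < 4 * (n + 1) * normSq α β (n + 1) := by
      rw [h]
      exact mul_pos (by linarith) h1
    exact pos_of_mul_pos_right h3 (by positivity)

lemma two_mul_sigma_nonneg (α β : ℝ) : 0 ≤ 2 * sigma α β :=
  mul_nonneg zero_le_two (le_max_left _ _)

lemma two_mul_add_one_le_left (α β : ℝ) : 2 * α + 1 ≤ 2 * sigma α β := by
  have h1 : 1 / 2 + max α β ≤ sigma α β := le_max_right _ _
  have h2 : α ≤ max α β := le_max_left _ _
  linarith

lemma two_mul_add_one_le_right (α β : ℝ) : 2 * β + 1 ≤ 2 * sigma α β := by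
  have h1 : 1 / 2 + max α β ≤ sigma α β := le_max_right _ _
  have h2 : β ≤ max α β := le_max_right _ _
  linarith

/-- At both endpoints the squared orthonormal polynomials are `O((n + 1) ^ (2σ))`. -/
lemma exists_endpoint_bound {α β : ℝ} (hα : -1 < α) (hβ : -1 < β) :
    ∃ C > 0, ∀ n : ℕ, 0 < n →
      (jacobi α β n).eval 1 ^ 2 ≤ C * ((n : ℝ) + 1) ^ (2 * sigma α β) * normSq α β n ∧
      (jacobi α β n).eval (-1) ^ 2 ≤ C * ((n : ℝ) + 1) ^ (2 * sigma α β) * normSq α β n := by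
  obtain ⟨C1, h1, H1⟩ := exists_ascPochhammer_ratio_le hα hβ
  obtain ⟨C2, h2, H2⟩ := exists_ascPochhammer_ratio_le hβ hα
  have hI := integral_weight_pos hα hβ
  refine ⟨max C1 C2 / ∫ t in (-1)..1, weight α β t, by positivity, fun n hn => ?_⟩
  have hn1 : (1 : ℝ) ≤ n := by exact_mod_cast hn
  have hN := normSq_eq hα hβ n
  have hNpos := normSq_pos hα hβ n
  have hA := ascPochhammer_pos n (α + 1) (by linarith)
  have hB := ascPochhammer_pos n (β + 1) (by linarith)
  have hD : 0 < n.factorial * (2 * n + α + β + 1) * (ascPochhammer ℝ n).eval (α + β + 2) :=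
    mul_pos (mul_pos (by positivity) (by linarith)) (ascPochhammer_pos n _ (by linarith))
  have hmono : ∀ e : ℝ, e ≤ 2 * sigma α β → (n : ℝ) ^ e ≤ ((n : ℝ) + 1) ^ (2 * sigma α β) :=
    fun e he => (Real.rpow_le_rpow_of_exponent_le hn1 he).trans
      (Real.rpow_le_rpow (by positivity) (by linarith) (two_mul_sigma_nonneg α β))
  have key : ∀ (y C e : ℝ), e ≤ 2 * sigma α β → C ≤ max C1 C2 →
      y ^ 2 * (n.factorial * (2 * n + α + β + 1) * (ascPochhammer ℝ n).eval (α + β + 2)) ≤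
        C * (n : ℝ) ^ e * ((ascPochhammer ℝ n).eval (α + 1) * (ascPochhammer ℝ n).eval (β + 1) *
          (n + α + β + 1)) →
      y ^ 2 ≤ max C1 C2 / (∫ t in (-1)..1, weight α β t) * ((n : ℝ) + 1) ^ (2 * sigma α β) *
        normSq α β n := by
    intro y C e he hC h
    have hE : 0 ≤ (ascPochhammer ℝ n).eval (α + 1) * (ascPochhammer ℝ n).eval (β + 1) *
          (n + α + β + 1) := mul_nonneg (by positivity) (by linarith)
    refine le_of_mul_le_mul_right ?_ hD
    calc _ ≤ _ := h
      _ ≤ max C1 C2 * ((n : ℝ) + 1) ^ (2 * sigma α β) *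
          ((ascPochhammer ℝ n).eval (α + 1) * (ascPochhammer ℝ n).eval (β + 1) *
          (n + α + β + 1)) := by
            gcongr
            exact hmono e he
      _ = max C1 C2 / (∫ t in (-1)..1, weight α β t) * ((n : ℝ) + 1) ^ (2 * sigma α β) *
          ((ascPochhammer ℝ n).eval (α + 1) * (ascPochhammer ℝ n).eval (β + 1) *
          (∫ t in (-1)..1, weight α β t) * (n + α + β + 1)) := by field_simp
      _ = _ := by rw [← hN]; ring
  constructor
  · refine key _ C1 _ (two_mul_add_one_le_left α β) (le_max_left _ _) ?_
    rw [eval_one_jacobi]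
    exact H1 n hn
  · refine key _ C2 _ (two_mul_add_one_le_right α β) (le_max_right _ _) ?_
    rw [eval_neg_one_jacobi hα hβ, mul_div_assoc, mul_pow, ← pow_mul, mul_comm n 2, pow_mul]
    have := H2 n hn
    rw [add_comm β α, show 2 * (n : ℝ) + β + α + 1 = 2 * n + α + β + 1 by ring,
      show (n : ℝ) + β + α + 1 = n + α + β + 1 by ring] at this
    refine (le_of_eq ?_).trans (this.trans (le_of_eq ?_))
    · norm_num
    · ring

/-! ### Sonin's function and the uniform bound -/

/-- Sonin's function `λ y² + (1 - t²) y'²`, with `y` the `n`-th Jacobi polynomial and `λ` its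
eigenvalue. -/
def sonin (α β : ℝ) (n : ℕ) : ℝ[X] :=
  C (n * (n + α + β + 1)) * jacobi α β n ^ 2 + (1 - X ^ 2) * derivative (jacobi α β n) ^ 2

lemma eval_derivative_sonin (α β : ℝ) (n : ℕ) (t : ℝ) :
    (derivative (sonin α β n)).eval t =
      2 * (α - β + (α + β + 1) * t) * (derivative (jacobi α β n)).eval t ^ 2 := by
  have h := congrArg (eval t) (jacobiOp_jacobi α β n)
  rw [jacobiOp] at h
  simp only [eval_add, eval_mul, eval_sub, eval_one, eval_pow, eval_X, eval_C, eval_neg] at h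
  simp only [sonin, derivative_add, derivative_mul, derivative_C, derivative_pow, derivative_sub,
    derivative_one, derivative_X, eval_add, eval_mul, eval_sub, eval_one, eval_pow, eval_X,
    eval_C, eval_zero]
  norm_num
  linear_combination 2 * (derivative (jacobi α β n)).eval t * h

lemma eval_sonin (α β : ℝ) (n : ℕ) (t : ℝ) :
    (sonin α β n).eval t = n * (n + α + β + 1) * (jacobi α β n).eval t ^ 2 +
      (1 - t ^ 2) * (derivative (jacobi α β n)).eval t ^ 2 := by
  simp [sonin]

lemma eigenvalue_pos {α β : ℝ} (hα : -1 < α) (hβ : -1 < β) {n : ℕ} (hn : 0 < n) :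
    (0 : ℝ) < n * (n + α + β + 1) := by
  have hn1 : (1 : ℝ) ≤ n := by exact_mod_cast hn
  exact mul_pos (by linarith) (by linarith)

lemma one_sub_sq_nonneg {t : ℝ} (ht : t ∈ Set.Icc (-1 : ℝ) 1) : 0 ≤ 1 - t ^ 2 := by
  nlinarith [ht.1, ht.2]

lemma le_eval_sonin (α β : ℝ) (n : ℕ) {t : ℝ} (ht : t ∈ Set.Icc (-1 : ℝ) 1) :
    n * (n + α + β + 1) * (jacobi α β n).eval t ^ 2 ≤ (sonin α β n).eval t := by
  rw [eval_sonin]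
  have := mul_nonneg (one_sub_sq_nonneg ht) (sq_nonneg ((derivative (jacobi α β n)).eval t))
  linarith

lemma sonin_le_of_nonneg {α β : ℝ} (n : ℕ) {a b : ℝ} (hab : a ≤ b)
    (h : ∀ t ∈ Set.Icc a b, 0 ≤ α - β + (α + β + 1) * t) :
    (sonin α β n).eval a ≤ (sonin α β n).eval b := by
  refine monotoneOn_of_deriv_nonneg (convex_Icc a b) (sonin α β n).continuousOn
    (sonin α β n).differentiableOn (fun t ht => ?_) (Set.left_mem_Icc.2 hab)
    (Set.right_mem_Icc.2 hab) hab
  rw [Polynomial.deriv, eval_derivative_sonin]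
  have := h t (interior_subset ht)
  positivity

lemma sonin_le_of_nonpos {α β : ℝ} (n : ℕ) {a b : ℝ} (hab : a ≤ b)
    (h : ∀ t ∈ Set.Icc a b, α - β + (α + β + 1) * t ≤ 0) :
    (sonin α β n).eval b ≤ (sonin α β n).eval a := by
  refine antitoneOn_of_deriv_nonpos (convex_Icc a b) (sonin α β n).continuousOn
    (sonin α β n).differentiableOn (fun t ht => ?_) (Set.left_mem_Icc.2 hab)
    (Set.right_mem_Icc.2 hab) hab
  rw [Polynomial.deriv, eval_derivative_sonin]
  exact mul_nonpos_of_nonpos_of_nonneg (by linarith [h t (interior_subset ht)]) (sq_nonneg _)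

/-- If one of the parameters is at least `-1/2`, Sonin's function has no interior maximum above
its endpoint values, so a Jacobi polynomial is largest at an endpoint. -/
lemma jacobi_sq_le_max {α β : ℝ} (hα : -1 < α) (hβ : -1 < β) (h : -1 / 2 ≤ α ∨ -1 / 2 ≤ β)
    {n : ℕ} (hn : 0 < n) {t : ℝ} (ht : t ∈ Set.Icc (-1 : ℝ) 1) :
    (jacobi α β n).eval t ^ 2 ≤
      max ((jacobi α β n).eval 1 ^ 2) ((jacobi α β n).eval (-1) ^ 2) := by
  have hl := eigenvalue_pos hα hβ hn
  have h1 : (sonin α β n).eval 1 = n * (n + α + β + 1) * (jacobi α β n).eval 1 ^ 2 := by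
    rw [eval_sonin]; ring
  have h2 : (sonin α β n).eval (-1) = n * (n + α + β + 1) * (jacobi α β n).eval (-1) ^ 2 := by
    rw [eval_sonin]; ring
  have h0 := le_eval_sonin α β n ht
  -- The sign of the derivative is that of an affine function, equal to `2α + 1` at `1` and
  -- to `-(2β + 1)` at `-1`.
  have hright : (∀ x ∈ Set.Icc t 1, 0 ≤ α - β + (α + β + 1) * x) →
      (jacobi α β n).eval t ^ 2 ≤ (jacobi α β n).eval 1 ^ 2 := fun hx =>
    le_of_mul_le_mul_left (h0.trans ((sonin_le_of_nonneg n ht.2 hx).trans_eq h1)) hl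
  have hleft : (∀ x ∈ Set.Icc (-1) t, α - β + (α + β + 1) * x ≤ 0) →
      (jacobi α β n).eval t ^ 2 ≤ (jacobi α β n).eval (-1) ^ 2 := fun hx =>
    le_of_mul_le_mul_left (h0.trans ((sonin_le_of_nonpos n ht.1 hx).trans_eq h2)) hl
  rcases le_total 0 (α + β + 1) with hc | hc
  · rcases le_total 0 (α - β + (α + β + 1) * t) with hs | hs
    · refine le_max_of_le_left (hright fun x hx => ?_)
      linarith [mul_le_mul_of_nonneg_left hx.1 hc]
    · refine le_max_of_le_right (hleft fun x hx => ?_)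
      linarith [mul_le_mul_of_nonneg_left hx.2 hc]
  · rcases h with h | h
    · refine le_max_of_le_left (hright fun x hx => ?_)
      linarith [mul_le_mul_of_nonpos_left hx.2 hc]
    · refine le_max_of_le_right (hleft fun x hx => ?_)
      linarith [mul_le_mul_of_nonpos_left hx.1 hc]

lemma integral_sonin {α β : ℝ} (hα : -1 < α) (hβ : -1 < β) (n : ℕ) :
    ∫ t in (-1)..1, (sonin α β n).eval t * weight α β t =
      2 * (n * (n + α + β + 1)) * normSq α β n := by
  have h := normSq_energy hα hβ n
  have e : ∫ t in (-1)..1, (sonin α β n).eval t * weight α β t =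
      (n * (n + α + β + 1)) * normSq α β n +
      ∫ t in (-1)..1, ((1 - t ^ 2) * (derivative (jacobi α β n)).eval t ^ 2) * weight α β t := by
    rw [normSq, ← intervalIntegral.integral_const_mul, ← intervalIntegral.integral_add]
    · congr 1 with t
      rw [eval_sonin]
      ring
    · exact (intervalIntegrable_mul_weight hα hβ (by fun_prop)).const_mul _
    · exact intervalIntegrable_mul_weight hα hβ (by fun_prop)
  rw [e, h]
  ring

/-- If both parameters are less than `-1/2`, Sonin's function is largest at an interior point
not depending on `n`, and it is comparable to its maximum on an interval that does not depend
on `n` either. So the maximum is at most a multiple of the integral of Sonin's function, which is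
`2 λ` times the squared norm. -/
lemma exists_jacobi_sq_le_normSq {α β : ℝ} (hα : -1 < α) (hβ : -1 < β) (hα' : α < -1 / 2)
    (hβ' : β < -1 / 2) :
    ∃ C > 0, ∀ n : ℕ, 0 < n → ∀ t ∈ Set.Icc (-1 : ℝ) 1,
      (jacobi α β n).eval t ^ 2 ≤ C * normSq α β n := by
  have hs : α + β + 1 < 0 := by linarith
  set x := (β - α) / (α + β + 1) with hx
  have hxl : (α + β + 1) * x = β - α := by rw [hx, mul_div_cancel₀ _ hs.ne]
  have hx1 : x < 1 := by rw [hx, div_lt_iff_of_neg hs]; linarith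
  have hx2 : -1 < x := by rw [hx, lt_div_iff_of_neg hs]; linarith
  set b := (1 + x) / 2 with hb
  have hxb : x < b := by rw [hb]; linarith
  have hb1 : b < 1 := by rw [hb]; linarith
  have hδ : 0 < (1 - b) * (1 + x) := mul_pos (by linarith) (by linarith)
  set δ := (1 - b) * (1 + x) with hδdef
  have hsub : Set.Icc x b ⊆ Set.Icc (-1 : ℝ) 1 := Set.Icc_subset_Icc hx2.le hb1.le
  have hi0 : IntervalIntegrable (weight α β) volume x b :=
    (intervalIntegrable_weight hα hβ).mono_set (by
      rw [Set.uIcc_of_le hxb.le, Set.uIcc_of_le (by norm_num)]; exact hsub)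
  have hc0 : 0 < ∫ t in x..b, weight α β t :=
    intervalIntegral.intervalIntegral_pos_of_pos_on hi0
      (fun t ht => weight_pos ⟨hx2.trans ht.1, ht.2.trans hb1⟩) hxb
  set c := ∫ t in x..b, weight α β t with hc
  refine ⟨2 * Real.exp (2 / δ * (b - x)) / c, by positivity, fun n hn t ht => ?_⟩
  have hl := eigenvalue_pos hα hβ hn
  have hnonneg : ∀ t ∈ Set.Icc (-1 : ℝ) 1, 0 ≤ (sonin α β n).eval t := fun t ht =>
    (mul_nonneg hl.le (sq_nonneg _)).trans (le_eval_sonin α β n ht)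
  have hmax : (sonin α β n).eval t ≤ (sonin α β n).eval x := by
    rcases le_total t x with htx | htx
    · refine sonin_le_of_nonneg n htx fun y hy => ?_
      nlinarith [mul_le_mul_of_nonpos_left hy.2 hs.le]
    · refine sonin_le_of_nonpos n htx fun y hy => ?_
      nlinarith [mul_le_mul_of_nonpos_left hy.1 hs.le]
  -- On `[x, b]` the logarithmic derivative of Sonin's function is at least `-2 / δ`.
  have hdecay : ∀ y ∈ Set.Icc x b, (sonin α β n).eval x ≤
      Real.exp (2 / δ * (b - x)) * (sonin α β n).eval y := by
    intro y hy
    have hd : ∀ z, HasDerivAt (fun z => (sonin α β n).eval z * Real.exp (2 / δ * z))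
        ((derivative (sonin α β n)).eval z * Real.exp (2 / δ * z) +
          (sonin α β n).eval z * (Real.exp (2 / δ * z) * (2 / δ * 1))) z := fun z =>
      ((sonin α β n).hasDerivAt z).mul (((hasDerivAt_id z).const_mul (2 / δ)).exp)
    have hmono : MonotoneOn (fun z => (sonin α β n).eval z * Real.exp (2 / δ * z))
        (Set.Icc x b) := by
      refine monotoneOn_of_deriv_nonneg (convex_Icc x b)
        (fun z _ => (hd z).continuousAt.continuousWithinAt)
        (fun z _ => (hd z).differentiableAt.differentiableWithinAt) fun z hz => ?_
      have hz := interior_subset hz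
      rw [(hd z).deriv, eval_derivative_sonin]
      have h1 : -1 ≤ α - β + (α + β + 1) * z := by
        nlinarith [mul_le_mul_of_nonpos_left (hsub hz).2 hs.le]
      have h2 : δ ≤ 1 - z ^ 2 := by
        rw [hδdef, show 1 - z ^ 2 = (1 - z) * (1 + z) by ring]
        exact mul_le_mul (by linarith [hz.2]) (by linarith [hz.1]) (by linarith)
          (by linarith [hz.2])
      have h3 : δ * (derivative (jacobi α β n)).eval z ^ 2 ≤ (sonin α β n).eval z := by
        rw [eval_sonin]
        have := mul_nonneg hl.le (sq_nonneg ((jacobi α β n).eval z))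
        have := mul_le_mul_of_nonneg_right h2 (sq_nonneg ((derivative (jacobi α β n)).eval z))
        linarith
      have h4 : (derivative (jacobi α β n)).eval z ^ 2 ≤ (sonin α β n).eval z / δ := by
        rw [le_div_iff₀ hδ]; linarith
      have h5 : 0 ≤ 2 * (α - β + (α + β + 1) * z) * (derivative (jacobi α β n)).eval z ^ 2 +
          (sonin α β n).eval z * (2 / δ) := by
        have := mul_le_mul_of_nonneg_right h1 (sq_nonneg ((derivative (jacobi α β n)).eval z))
        have e : (sonin α β n).eval z * (2 / δ) = 2 * ((sonin α β n).eval z / δ) := by ring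
        rw [e]
        linarith
      have := mul_nonneg h5 (Real.exp_pos (2 / δ * z)).le
      linarith
    have h := hmono (Set.left_mem_Icc.2 hxb.le) hy hy.1
    have hy0 := hnonneg y (hsub hy)
    have e : (sonin α β n).eval x = (sonin α β n).eval x * Real.exp (2 / δ * x) *
        Real.exp (-(2 / δ * x)) := by
      rw [mul_assoc, ← Real.exp_add, add_neg_cancel, Real.exp_zero, mul_one]
    rw [e]
    calc _ ≤ (sonin α β n).eval y * Real.exp (2 / δ * y) * Real.exp (-(2 / δ * x)) := by
          gcongr
      _ = Real.exp (2 / δ * (y - x)) * (sonin α β n).eval y := by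
          rw [mul_assoc, ← Real.exp_add, mul_comm]
          congr 2; ring
      _ ≤ _ := by
          gcongr
          exact hy.2
  have hint : (sonin α β n).eval x * c ≤ Real.exp (2 / δ * (b - x)) *
      (2 * (n * (n + α + β + 1)) * normSq α β n) := by
    rw [hc, ← intervalIntegral.integral_const_mul, ← integral_sonin hα hβ,
      ← intervalIntegral.integral_const_mul]
    have hi := (intervalIntegrable_mul_weight hα hβ (sonin α β n).continuous).const_mul
      (Real.exp (2 / δ * (b - x)))
    have hi' := hi.mono_set (c := x) (d := b) (by
      rw [Set.uIcc_of_le hxb.le, Set.uIcc_of_le (by norm_num)]; exact hsub)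
    refine (intervalIntegral.integral_mono_on hxb.le (hi0.const_mul _) hi' fun y hy => ?_).trans
      (intervalIntegral.integral_mono_interval hx2.le hxb.le hb1.le ?_ hi)
    · rw [← mul_assoc]
      exact mul_le_mul_of_nonneg_right (hdecay y hy) (weight_nonneg (hsub hy))
    · filter_upwards [ae_restrict_mem measurableSet_Ioc] with y hy
      have hy' : y ∈ Set.Icc (-1 : ℝ) 1 := ⟨hy.1.le, hy.2⟩
      exact mul_nonneg (Real.exp_pos _).le (mul_nonneg (hnonneg y hy') (weight_nonneg hy'))
  refine le_of_mul_le_mul_left ((le_eval_sonin α β n ht).trans (hmax.trans ?_)) hl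
  rw [← le_div_iff₀ hc0] at hint
  refine hint.trans (le_of_eq ?_)
  ring

lemma exists_jacobi_sq_le {α β : ℝ} (hα : -1 < α) (hβ : -1 < β) :
    ∃ C > 0, ∀ n : ℕ, ∀ t ∈ Set.Icc (-1 : ℝ) 1,
      (jacobi α β n).eval t ^ 2 ≤ C * ((n : ℝ) + 1) ^ (2 * sigma α β) * normSq α β n := by
  obtain ⟨C, hC, H⟩ : ∃ C > 0, ∀ n : ℕ, 0 < n → ∀ t ∈ Set.Icc (-1 : ℝ) 1,
      (jacobi α β n).eval t ^ 2 ≤ C * ((n : ℝ) + 1) ^ (2 * sigma α β) * normSq α β n := by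
    by_cases h : -1 / 2 ≤ α ∨ -1 / 2 ≤ β
    · obtain ⟨C, hC, H⟩ := exists_endpoint_bound hα hβ
      exact ⟨C, hC, fun n hn t ht =>
        (jacobi_sq_le_max hα hβ h hn ht).trans (max_le (H n hn).1 (H n hn).2)⟩
    · push Not at h
      obtain ⟨C, hC, H⟩ := exists_jacobi_sq_le_normSq hα hβ h.1 h.2
      refine ⟨C, hC, fun n hn t ht => (H n hn t ht).trans ?_⟩
      have h1 : (1 : ℝ) ≤ ((n : ℝ) + 1) ^ (2 * sigma α β) :=
        Real.one_le_rpow (by linarith [(n.cast_nonneg : (0 : ℝ) ≤ n)]) (two_mul_sigma_nonneg α β)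
      exact mul_le_mul_of_nonneg_right (le_mul_of_one_le_right hC.le h1) (normSq_pos hα hβ n).le
  have h0 := normSq_pos hα hβ 0
  refine ⟨max C (normSq α β 0)⁻¹, by positivity, fun n t ht => ?_⟩
  rcases n.eq_zero_or_pos with rfl | hn
  · simp only [jacobi_zero, eval_one, Nat.cast_zero, zero_add, Real.one_rpow, mul_one, one_pow]
    rw [← inv_mul_cancel₀ h0.ne']
    exact mul_le_mul_of_nonneg_right (le_max_right _ _) h0.le
  · refine (H n hn t ht).trans ?_
    have := normSq_pos hα hβ n
    gcongr
    exact le_max_left _ _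

/-! ### The system of orthonormal Jacobi polynomials -/

lemma jacobiNorm_eq (α β : ℝ) (n : ℕ) : jacobiNorm α β n = √(normSq α β n) := by
  rw [jacobiNorm, integral_weightMeasure, normSq]

/-- The orthonormal Jacobi polynomials are bounded by `K (n + 1) ^ σ` on `[-1, 1]`. -/
theorem exists_isBoundedOrthonormal {α β : ℝ} (hα : -1 < α) (hβ : -1 < β) :
    ∃ K : ℝ≥0, IsBoundedOrthonormal (weightMeasure α β)
      (fun n t => (orthonormalJacobi α β n).eval t) (fun n => ((n : ℝ) + 1) ^ sigma α β) K := by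
  obtain ⟨C, hC, H⟩ := exists_jacobi_sq_le hα hβ
  have hnorm : ∀ n, 0 < jacobiNorm α β n := fun n => by
    rw [jacobiNorm_eq]
    exact Real.sqrt_pos.2 (normSq_pos hα hβ n)
  have hsq : ∀ n, jacobiNorm α β n ^ 2 = normSq α β n := fun n => by
    rw [jacobiNorm_eq, Real.sq_sqrt (normSq_pos hα hβ n).le]
  refine ⟨(√C).toNNReal, ⟨fun n => ?_, fun n => ?_, fun n m => ?_⟩⟩
  · exact (Polynomial.continuous _).aestronglyMeasurable
  · filter_upwards [ae_weightMeasure_mem α β] with t ht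
    have hn : (0 : ℝ) ≤ (n : ℝ) + 1 := by positivity
    simp only [orthonormalJacobi, eval_mul, eval_C, Real.coe_toNNReal _ (Real.sqrt_nonneg C)]
    refine abs_le_of_sq_le_sq ?_ (by positivity)
    rw [mul_pow, mul_pow, Real.sq_sqrt hC.le, inv_pow, hsq, inv_mul_le_iff₀ (normSq_pos hα hβ n),
      ← Real.rpow_natCast (_ ^ _) 2, ← Real.rpow_mul hn]
    refine (H n t ht).trans (le_of_eq ?_)
    push_cast
    rw [mul_comm (sigma α β) 2]
    ring
  · have e : ∀ t, (orthonormalJacobi α β n).eval t * (orthonormalJacobi α β m).eval t *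
        weight α β t = (jacobiNorm α β n)⁻¹ * (jacobiNorm α β m)⁻¹ *
        ((jacobi α β n * jacobi α β m).eval t * weight α β t) := fun t => by
      simp only [orthonormalJacobi, eval_mul, eval_C]
      ring
    rw [integral_weightMeasure]
    simp only [e, intervalIntegral.integral_const_mul]
    split_ifs with hnm
    · subst hnm
      have : ∫ t in (-1)..1, (jacobi α β n * jacobi α β n).eval t * weight α β t =
          jacobiNorm α β n ^ 2 := by
        rw [hsq, normSq]
        congr 1 with t
        rw [eval_mul, sq]
      rw [this]
      have := (hnorm n).ne'
      field_simp
    · rw [integral_jacobi_mul_jacobi hα hβ hnm, mul_zero]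

lemma levelSup_eq_M (α β : ℝ) (ω : ℕ → ℝ) :
    levelSup (fun n => ((n : ℝ) + 1) ^ sigma α β) ω = M α β ω := by
  have h : ∀ n : ℕ, (((n : ℝ) + 1) ^ sigma α β) ^ 2 = ((n : ℝ) + 1) ^ (2 * sigma α β) := fun n => by
    rw [← Real.rpow_natCast (_ ^ _) 2, ← Real.rpow_mul (by positivity)]
    push_cast
    rw [mul_comm]
  simp only [levelSup, M, h]

lemma paleySum_eq {α β : ℝ} {ω : ℕ → ℝ} (hω : ∀ n, 0 < ω n) (r : ℝ) (c : ℕ → ℂ) :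
    paleySum α β ω r c = ∑' n : ℕ, ENNReal.ofReal
      (((((n : ℝ) + 1) ^ sigma α β * ω n) ^ expDiff r * ‖c n‖) ^ r) := by
  unfold paleySum
  congr 1 with n
  rw [Real.mul_rpow (by positivity) (hω n).le, ← Real.rpow_mul (by positivity),
    mul_comm (expDiff r)]

end JacobiExpansion

end


theorem theorem1 (α β : ℝ) (hα : -1 < α) (hβ : -1 < β) :
    ∃ A : ℝ → ℝ≥0,
      (∀ p : ℝ, 1 < p → p ≤ 2 →
        ∀ f : ℝ → ℂ, MemLp f (ENNReal.ofReal p) (JacobiExpansion.weightMeasure α β) →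
        ∀ ω : ℕ → ℝ, (∀ n, 0 < ω n) → JacobiExpansion.M α β ω < ⊤ →
          (JacobiExpansion.paleySum α β ω p (JacobiExpansion.coeff α β f)) ^ (1 / p) ≤
            (A p : ℝ≥0∞) *
              (JacobiExpansion.M α β ω) ^ (1 / p - 1 / Real.conjExponent p) *
              eLpNorm f (ENNReal.ofReal p) (JacobiExpansion.weightMeasure α β)) ∧
      (∀ q : ℝ, 2 ≤ q →
        ∀ ω : ℕ → ℝ, (∀ n, 0 < ω n) → JacobiExpansion.M α β ω < ⊤ →
        ∀ φ : ℕ → ℝ, (∀ n, 0 ≤ φ n) →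
          JacobiExpansion.paleySum α β ω q (fun n => (φ n : ℂ)) < ⊤ →
          ∃ f : ℝ → ℂ,
            MemLp f (ENNReal.ofReal q) (JacobiExpansion.weightMeasure α β) ∧
            Tendsto
              (fun N : ℕ => eLpNorm (fun t => JacobiExpansion.partialSum α β φ N t - f t)
                (ENNReal.ofReal q) (JacobiExpansion.weightMeasure α β))
              atTop (𝓝 0) ∧
            (∀ n, JacobiExpansion.coeff α β f n = (φ n : ℂ)) ∧
            eLpNorm f (ENNReal.ofReal q) (JacobiExpansion.weightMeasure α β) ≤
              (A (Real.conjExponent q) : ℝ≥0∞) *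
                (JacobiExpansion.M α β ω) ^ (1 / Real.conjExponent q - 1 / q) *
                (JacobiExpansion.paleySum α β ω q (fun n => (φ n : ℂ))) ^ (1 / q)) := by
  obtain ⟨K, hu⟩ := JacobiExpansion.exists_isBoundedOrthonormal hα hβ
  have := JacobiExpansion.isFiniteMeasure_weightMeasure hα hβ
  have ha : ∀ n : ℕ, 0 < ((n : ℝ) + 1) ^ JacobiExpansion.sigma α β := fun n => by positivity
  refine ⟨JacobiExpansion.paleyConstant K, fun p hp hp2 f hf ω hω hM => ?_,
    fun q hq ω hω hM φ _ hS => ?_⟩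
  · rw [← JacobiExpansion.levelSup_eq_M] at hM ⊢
    rw [JacobiExpansion.paleySum_eq hω]
    exact hu.paley ha hω hM hp hp2 hf
  · have hpq : q.HolderConjugate q.conjExponent := .conjExponent (by linarith)
    have he : 1 / q.conjExponent - 1 / q = JacobiExpansion.expDiff q.conjExponent := by
      have h : q.conjExponent.conjExponent = q := hpq.symm.conjugate_eq.symm
      rw [JacobiExpansion.expDiff, h]
    rw [← JacobiExpansion.levelSup_eq_M] at hM ⊢
    rw [JacobiExpansion.paleySum_eq hω] at hS ⊢
    rw [he]
    exact hu.paley_dual ha hω hM hq φ hS
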